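/- **Setting.** Let $\Omega\subset\mathbb R^2$ be a polygonal domain (open, connected, with $\Omega=\operatorname{int}\overline\Omega$). Let $\mathcal T_u$ be a finite mesh of $\overline\Omega$ by closed polygons with disjoint interiors that meet edge to edge (hanging nodes count as vertices of every polygon containing them). Each polygon $S=S(\nu)$ carries an interior point $\nu$, and joining $\nu$ to all vertices of $S$ cuts $S$ into non-degenerate closed triangles with disjoint interiors; $\mathcal T_h$ is the resulting conforming triangulation of $\overline\Omega$. Let $\mathcal F_u$ be the set of edges of the polygons, $\mathcal F_u^0$ the set of those not lying on $\partial\Omega$, and $\mathcal F_p$ the set of the edges joining the points $\nu$ to the vertices of their polygons. Write $h_e$ for the length of an edge $e$ and $h_S$ for the diameter of $S$. The mesh is called $(\rho,c)$-regular if every $S(\nu)\in\mathcal T_u$ is star-shaped with respect to the ball of radius $\rho h_{S}$ about $\nu$, and every edge $e$ of $S(\nu)$ satisfies $h_e\ge c\,h_{S}$. On each edge $e$ fix a unit normal $\bm n$ (pointing out of $\Omega$ if $e\subset\partial\Omega$) and the corresponding unit tangent $\bm t$. For a quantity $\phi$ defined triangle by triangle, the jump on $e$ is $[\phi]=\sum_{\tau\in\mathcal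 T_h,\,e\subset\partial\tau}\delta_\tau\,\phi|_\tau$, where $\delta_\tau=\bm n_\tau\cdot\bm n=\pm1$ and $\bm n_\tau$ is the outward unit normal of $\tau$ on $e$ (on a boundary edge the sum has one term). Let $k\ge0$, let $P^k$ denote polynomials of degree at most $k$, and let $\nabla_h$ be the elementwise gradient. Define $$U^h=\{\bm v:\ \bm v|_\tau\in P^k(\tau)^2\ \forall\tau\in\mathcal T_h,\ \bm v\cdot\bm n\text{ is continuous over every }e\in\mathcal F_p\},$$ $$W^h=\{G:\ G|_\tau\in P^k(\tau)^{2\times2}\ \forall\tau\in\mathcal T_h,\ G\bm n\text{ is continuous over every }e\in\mathcal F_u^0\},$$ $$\widehat W^h=\Big\{G\in W^h:\ \int_e[G\bm n]\cdot\widehat{\bm v}\,ds=0\ \ \forall e\in\mathcal F_p,\ \forall\,\widehat{\bm v}\in P^k(e)^2\text{ with }\widehat{\bm v}\cdot\bm n=0\text{ on }e\Big\}.$$ (For $G\in\widehat W^h$, $G\bm n$ is single-valued on $\mathcal F_u$ and $(G\bm n)\cdot\bm t$ is single-valued on $\mathcal F_p$.) For $G\in\widehat W^h$ and $\bm v\in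 U^h$ put $$B_h(G,\bm v)=\int_\Omega G:\nabla_h\bm v\,dx-\sum_{e\in\mathcal F_u}\int_e[\bm v]\cdot(G\bm n)\,ds-\sum_{e\in\mathcal F_p}\int_e[(\bm v\cdot\bm t)\,\bm t\cdot(G\bm n)]\,ds,$$ $$\|\bm v\|_{Z_2}^2=\|\nabla_h\bm v\|_{L^2(\Omega)}^2+\sum_{e\in\mathcal F_u}h_e^{-1}\|[\bm v]\|_{L^2(e)}^2+\sum_{e\in\mathcal F_p}h_e^{-1}\|[(\bm v\cdot\bm t)\bm t]\|_{L^2(e)}^2,$$ $$\|G\|_{X'}^2=\|G\|_{L^2(\Omega)}^2+\sum_{e\in\mathcal F_u}h_e\|G\bm n\|_{L^2(e)}^2+\sum_{e\in\mathcal F_p}h_e\|(G\bm n)\cdot\bm t\|_{L^2(e)}^2.$$ **Theorem.** For all $k\ge0$, $\rho>0$ and $c>0$ there is a constant $C>0$, depending only on $k$, $\rho$ and $c$, such that for every polygonal domain $\Omega$ and every $(\rho,c)$-regular mesh of $\Omega$ as above, $$\inf_{0\ne\bm v\in U^h}\ \sup_{0\ne G\in\widehat W^h}\ \frac{B_h(G,\bm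 v)}{\|G\|_{X'}\,\|\bm v\|_{Z_2}}\ \ge\ C.$$ -/

import Mathlib

open scoped Matrix

noncomputable section

namespace SDG

/-- The Euclidean plane. -/
abbrev Pt : Type := EuclideanSpace ℝ (Fin 2)

/-! ### Edges: unordered pairs of endpoints -/

/-- The closed segment with endpoints `e`. -/
def edgeSet (e : Sym2 Pt) : Set Pt := convexHull ℝ {x | x ∈ e}

/-- The length `h_e`. -/
def edgeLength (e : Sym2 Pt) : ℝ := Sym2.lift ⟨fun a b => dist a b, dist_comm⟩ e

/-- The arc-length integral `∫_e f ds`, computed by the affine parametrization of the segment. -/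
def edgeIntegral (f : Pt → ℝ) (e : Sym2 Pt) : ℝ :=
  Sym2.lift ⟨fun a b => dist a b * ∫ s in (0 : ℝ)..1, f (AffineMap.lineMap a b s), by
    intro a b
    have h := intervalIntegral.integral_comp_sub_left
      (fun s : ℝ => f (AffineMap.lineMap b a s)) (a := 0) (b := 1) 1
    simp only [AffineMap.lineMap_apply_one_sub, sub_self, sub_zero] at h
    simp only [dist_comm a b, h]⟩ e

/-! ### Polynomials -/

/-- `P^k`: real polynomials in two variables of total degree at most `k`. -/
def P (k : ℕ) : Submodule ℝ (MvPolynomial (Fin 2) ℝ) :=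
  MvPolynomial.restrictTotalDegree (Fin 2) ℝ k

/-- Value of a polynomial at a point of the plane. -/
def pval (p : MvPolynomial (Fin 2) ℝ) (x : Pt) : ℝ := MvPolynomial.eval (fun j => x j) p

/-- Value of a polynomial vector field. -/
def vval (p : Fin 2 → MvPolynomial (Fin 2) ℝ) (x : Pt) : Fin 2 → ℝ := fun i => pval (p i) x

/-- Value of a polynomial matrix field. -/
def mval (p : Matrix (Fin 2) (Fin 2) (MvPolynomial (Fin 2) ℝ)) (x : Pt) :
    Matrix (Fin 2) (Fin 2) ℝ := Matrix.of fun i j => pval (p i j) x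

/-- The gradient `(∇ v)_{ij} = ∂_j v_i`. -/
def grad (p : Fin 2 → MvPolynomial (Fin 2) ℝ) :
    Matrix (Fin 2) (Fin 2) (MvPolynomial (Fin 2) ℝ) :=
  Matrix.of fun i j => MvPolynomial.pderiv j (p i)

/-- The Frobenius product `A : B`. -/
def frob (A B : Matrix (Fin 2) (Fin 2) ℝ) : ℝ := ∑ i, ∑ j, A i j * B i j

/-! ### Meshes -/

/-- The data of a polygonal primal mesh with its triangular submesh: finitely many cells, each with
its vertices in cyclic order and an interior point `ν`; and a vector for every edge, which
will be its fixed unit normal (values at pairs that are not edges are irrelevant). -/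
structure MeshData where
  numCells : ℕ
  numVert : Fin numCells → ℕ
  ν : Fin numCells → Pt
  vertex : (S : Fin numCells) → Fin (numVert S) → Pt
  normal : Sym2 Pt → Fin 2 → ℝ

namespace MeshData

variable (M : MeshData)

/-- Indices of the triangles of `𝒯_h`: a cell `S` and one of its sides, from the vertex number `i`
to the next vertex in cyclic order. -/
abbrev Tri : Type := (S : Fin M.numCells) × Fin (M.numVert S)

/-- First vertex of the side of the cell that belongs to the triangle. -/
def va (τ : M.Tri) : Pt := M.vertex τ.1 τ.2

/-- Second vertex of that side (`finRotate` is the cyclic successor). -/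
def vb (τ : M.Tri) : Pt := M.vertex τ.1 (finRotate _ τ.2)

/-- The interior point of the cell that contains the triangle. -/
def vc (τ : M.Tri) : Pt := M.ν τ.1

def triVerts (τ : M.Tri) : Set Pt := {M.vc τ, M.va τ, M.vb τ}

/-- The closed triangle. -/
def triSet (τ : M.Tri) : Set Pt := convexHull ℝ (M.triVerts τ)

/-- The primal cell `S(ν)`, the union of its triangles. -/
def cellSet (S : Fin M.numCells) : Set Pt := ⋃ i : Fin (M.numVert S), M.triSet ⟨S, i⟩

open Classical in
/-- The three edges of a triangle. -/
def triEdges (τ : M.Tri) : Finset (Sym2 Pt) :=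
  {s(M.va τ, M.vb τ), s(M.vc τ, M.va τ), s(M.vc τ, M.vb τ)}

open Classical in
/-- The primal edges `ℱ_u`. -/
def Fu : Finset (Sym2 Pt) := Finset.univ.image fun τ : M.Tri => s(M.va τ, M.vb τ)

open Classical in
/-- The dual edges `ℱ_p`: they join the interior point of a cell to its vertices. -/
def Fp : Finset (Sym2 Pt) := Finset.univ.image fun τ : M.Tri => s(M.vc τ, M.va τ)

open Classical in
/-- The triangles that have `e` as an edge. -/
def adj (e : Sym2 Pt) : Finset M.Tri := Finset.univ.filter fun τ => e ∈ M.triEdges τ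

/-- The fixed normal of the edge `e` points to the outside of the triangle `τ`. -/
def IsOutward (τ : M.Tri) (e : Sym2 Pt) : Prop :=
  ∀ x ∈ M.triVerts τ, ∀ y ∈ e, M.normal e ⬝ᵥ (x - y).ofLp ≤ 0

/-- The unit tangent vector that corresponds to the unit normal. -/
def tangent (e : Sym2 Pt) : Fin 2 → ℝ := ![-M.normal e 1, M.normal e 0]

open Classical in
/-- The sign `δ = n_τ ⬝ n_e`. -/
def sgn (τ : M.Tri) (e : Sym2 Pt) : ℝ := if M.IsOutward τ e then 1 else -1

/-- `M` is a mesh of the domain `Ω`: the triangles of the submesh are non-degenerate, have disjoint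
interiors, fit together edge to edge (so hanging nodes count as vertices of all the cells that
contain them), and fill the closure of `Ω`; the edge normals are unit normals, and point
outwards on `∂Ω`. -/
structure IsMeshOf (Ω : Set Pt) : Prop where
  three_le : ∀ S, 3 ≤ M.numVert S
  nondegenerate : ∀ τ : M.Tri, AffineIndependent ℝ ![M.vc τ, M.va τ, M.vb τ]
  disjoint : ∀ τ τ' : M.Tri, τ ≠ τ' → Disjoint (interior (M.triSet τ)) (interior (M.triSet τ'))
  conforming : ∀ τ τ' : M.Tri,
    M.triSet τ ∩ M.triSet τ' ⊆ convexHull ℝ (M.triVerts τ ∩ M.triVerts τ')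
  cover : ⋃ S, M.cellSet S = closure Ω
  normal_unit : ∀ τ : M.Tri, ∀ e ∈ M.triEdges τ, M.normal e ⬝ᵥ M.normal e = 1
  normal_orth : ∀ τ : M.Tri, ∀ e ∈ M.triEdges τ, ∀ x ∈ e, ∀ y ∈ e,
    M.normal e ⬝ᵥ (x - y).ofLp = 0
  normal_boundary : ∀ e ∈ M.Fu, edgeSet e ⊆ frontier Ω → ∀ τ ∈ M.adj e, M.IsOutward τ e

/-- Mesh regularity: with `h_S` the diameter of the cell `S = S(ν)`, the cell is star-shaped with
respect to the ball of radius `ρ h_S` about `ν`, and its sides have length at least `c h_S`. -/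
structure IsRegular (ρ c : ℝ) : Prop where
  star : ∀ S, ∀ y ∈ Metric.ball (M.ν S) (ρ * Metric.diam (M.cellSet S)),
    StarConvex ℝ y (M.cellSet S)
  side : ∀ τ : M.Tri, c * Metric.diam (M.cellSet τ.1) ≤ dist (M.va τ) (M.vb τ)

/-! ### Piecewise polynomial fields

A piecewise polynomial field is the family of its restrictions to the triangles. -/

/-- Piecewise polynomial vector fields. -/
abbrev VField : Type := M.Tri → Fin 2 → MvPolynomial (Fin 2) ℝ

/-- Piecewise polynomial matrix fields. -/
abbrev MField : Type := M.Tri → Matrix (Fin 2) (Fin 2) (MvPolynomial (Fin 2) ℝ)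

/-- The jump `[v]` on `e`; on a boundary edge it is the trace. -/
def jump (v : M.VField) (e : Sym2 Pt) (x : Pt) : Fin 2 → ℝ :=
  ∑ τ ∈ M.adj e, M.sgn τ e • vval (v τ) x

/-- The jump `[(v ⬝ t) t]` on `e`. -/
def jumpTan (v : M.VField) (e : Sym2 Pt) (x : Pt) : Fin 2 → ℝ :=
  ∑ τ ∈ M.adj e, M.sgn τ e • ((vval (v τ) x ⬝ᵥ M.tangent e) • M.tangent e)

/-- The jump `[G n]` on `e`. -/
def jumpNormal (G : M.MField) (e : Sym2 Pt) (x : Pt) : Fin 2 → ℝ :=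
  ∑ τ ∈ M.adj e, M.sgn τ e • (mval (G τ) x *ᵥ M.normal e)

/-- The jump `[(v ⬝ t) t ⬝ (G n)]` on `e`. -/
def jumpMixed (G : M.MField) (v : M.VField) (e : Sym2 Pt) (x : Pt) : ℝ :=
  ∑ τ ∈ M.adj e, M.sgn τ e *
    (((vval (v τ) x ⬝ᵥ M.tangent e) • M.tangent e) ⬝ᵥ (mval (G τ) x *ᵥ M.normal e))

/-- The trace `G n` on `e`. It is used where it (or the component of it that is used) takes
the same value from all the triangles at `e`; the average is then that common value. -/
def normalTrace (G : M.MField) (e : Sym2 Pt) (x : Pt) : Fin 2 → ℝ :=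
  ((M.adj e).card : ℝ)⁻¹ • ∑ τ ∈ M.adj e, mval (G τ) x *ᵥ M.normal e

/-- `U^h`. -/
def U (k : ℕ) : Set M.VField :=
  {v | (∀ τ i, v τ i ∈ P k) ∧
    ∀ e ∈ M.Fp, ∀ τ ∈ M.adj e, ∀ τ' ∈ M.adj e, ∀ x ∈ edgeSet e,
      vval (v τ) x ⬝ᵥ M.normal e = vval (v τ') x ⬝ᵥ M.normal e}

/-- `W^h`; the interior primal edges are those that do not lie on `∂Ω`. -/
def W (Ω : Set Pt) (k : ℕ) : Set M.MField :=
  {G | (∀ τ i j, G τ i j ∈ P k) ∧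
    ∀ e ∈ M.Fu, ¬ edgeSet e ⊆ frontier Ω → ∀ τ ∈ M.adj e, ∀ τ' ∈ M.adj e, ∀ x ∈ edgeSet e,
      mval (G τ) x *ᵥ M.normal e = mval (G τ') x *ᵥ M.normal e}

/-- `Û^h`: polynomial vector fields of degree at most `k` on each dual edge, with vanishing
normal component. -/
def UHat (k : ℕ) : Set (Sym2 Pt → Fin 2 → MvPolynomial (Fin 2) ℝ) :=
  {w | ∀ e ∈ M.Fp, (∀ i, w e i ∈ P k) ∧ ∀ x ∈ edgeSet e, vval (w e) x ⬝ᵥ M.normal e = 0}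

/-- `Ŵ^h`. -/
def WHat (Ω : Set Pt) (k : ℕ) : Set M.MField :=
  {G | G ∈ M.W Ω k ∧ ∀ w ∈ M.UHat k, ∀ e ∈ M.Fp,
    edgeIntegral (fun x => M.jumpNormal G e x ⬝ᵥ vval (w e) x) e = 0}

/-- The bilinear form `B_h(G, v)`. -/
def B (G : M.MField) (v : M.VField) : ℝ :=
  (∑ τ, ∫ x in M.triSet τ, frob (mval (G τ) x) (mval (grad (v τ)) x))
  - (∑ e ∈ M.Fu, edgeIntegral (fun x => M.jump v e x ⬝ᵥ M.normalTrace G e x) e)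
  - ∑ e ∈ M.Fp, edgeIntegral (fun x => M.jumpMixed G v e x) e

/-- The norm `‖v‖_{Z_2}`. -/
def normZ2 (v : M.VField) : ℝ :=
  √((∑ τ, ∫ x in M.triSet τ, frob (mval (grad (v τ)) x) (mval (grad (v τ)) x))
    + (∑ e ∈ M.Fu, (edgeLength e)⁻¹ * edgeIntegral (fun x => M.jump v e x ⬝ᵥ M.jump v e x) e)
    + ∑ e ∈ M.Fp, (edgeLength e)⁻¹ *
        edgeIntegral (fun x => M.jumpTan v e x ⬝ᵥ M.jumpTan v e x) e)

/-- The norm `‖G‖_{X'}`. -/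
def normX' (G : M.MField) : ℝ :=
  √((∑ τ, ∫ x in M.triSet τ, frob (mval (G τ) x) (mval (G τ) x))
    + (∑ e ∈ M.Fu, edgeLength e *
        edgeIntegral (fun x => M.normalTrace G e x ⬝ᵥ M.normalTrace G e x) e)
    + ∑ e ∈ M.Fp, edgeLength e *
        edgeIntegral (fun x => (M.normalTrace G e x ⬝ᵥ M.tangent e) ^ 2) e)

end MeshData

end SDG

end

/-!
On each triangle the constant matrices have a basis dual to the degrees of freedom of `Ŵ^h`: both
components of `G n` on the side of the polygon, and `t · G n` on the two interior edges. Given `v`,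
the test field `G` has at the dual matrix `Λ_m` the coefficient `-h_e⁻¹ j_m + θ λ_m (Λ_m : ∇v)`.
Here `j_m` is the matching component of the jump of `v` on its edge `e`, extended to the triangle
constantly along a direction transversal to `e`, and `λ_m` is the barycentric coordinate vanishing
on `e`. The first part reproduces the jump terms of `‖v‖_{Z₂}`; the second one leaves the traces of
`G` unchanged and, by equivalence of norms on `P^k`, controls `∇_h v` as soon as `θ` is large. Shape
regularity bounds the dual matrices, hence `‖G‖_{X'}` by `‖v‖_{Z₂}`.
-/

namespace SDG

open MvPolynomial MeasureTheory Filter Topology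

/-! ### Polynomials on the plane -/

section TotalDegree

variable {σ R : Type*} [CommSemiring R]

lemma totalDegree_mul_pderiv_le {l : MvPolynomial σ R} (hl : l.totalDegree ≤ 1)
    (p : MvPolynomial σ R) (j : σ) : (l * pderiv j p).totalDegree ≤ p.totalDegree := by
  rw [p.as_sum, map_sum, Finset.mul_sum, ← p.as_sum]
  refine totalDegree_finsetSum_le fun s hs => ?_
  rw [pderiv_monomial]
  by_cases h : s j = 0
  · simp [h]
  · have hs_deg : ((s - Finsupp.single j 1).sum fun _ e => e) + 1 = s.sum fun _ e => e := by
      conv_rhs => rw [← Finsupp.sub_add_single_one_cancel h]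
      rw [Finsupp.sum_add_index' (fun _ => rfl) fun _ _ _ => rfl, Finsupp.sum_single_index rfl]
    calc _ ≤ 1 + (s - Finsupp.single j 1).sum fun _ e => e :=
          (totalDegree_mul _ _).trans (add_le_add hl (totalDegree_monomial_le _ _))
      _ ≤ p.totalDegree := by
          rw [add_comm, hs_deg]
          exact le_totalDegree hs

lemma totalDegree_bind₁_le {τ : Type*} {f : σ → MvPolynomial τ R}
    (hf : ∀ i, (f i).totalDegree ≤ 1) (p : MvPolynomial σ R) :
    (bind₁ f p).totalDegree ≤ p.totalDegree := by
  rw [p.as_sum, map_sum, ← p.as_sum]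
  refine totalDegree_finsetSum_le fun s hs => ?_
  rw [bind₁_monomial]
  calc _ ≤ (∏ i ∈ s.support, f i ^ s i).totalDegree := by
        simpa using totalDegree_mul (C (coeff s p)) (∏ i ∈ s.support, f i ^ s i)
    _ ≤ ∑ i ∈ s.support, (f i ^ s i).totalDegree := totalDegree_finsetProd _ _
    _ ≤ ∑ i ∈ s.support, s i := Finset.sum_le_sum fun i _ =>
        (totalDegree_pow _ _).trans <| by simpa using Nat.mul_le_mul_left (s i) (hf i)
    _ ≤ p.totalDegree := le_totalDegree hs

lemma eq_C_of_pderiv_eq_zero [NoZeroDivisors R] [CharZero R] {p : MvPolynomial σ R}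
    (h : ∀ j, pderiv j p = 0) : p = C (coeff 0 p) := by
  classical
  ext s
  rcases eq_or_ne s 0 with rfl | hs
  · simp
  obtain ⟨j, hj⟩ := Finsupp.ne_iff.1 hs
  have hcoeff : coeff (s - Finsupp.single j 1) (pderiv j p) = 0 := by rw [h j, coeff_zero]
  rw [coeff_pderiv, Finsupp.sub_add_single_one_cancel hj] at hcoeff
  rw [coeff_C, if_neg hs.symm]
  exact (mul_eq_zero.1 hcoeff).resolve_right (Nat.cast_add_one_ne_zero _)

end TotalDegree

section PlanePolynomials

variable {k : ℕ} {p : MvPolynomial (Fin 2) ℝ}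

@[simp] lemma pval_zero (x : Pt) : pval 0 x = 0 := map_zero _

@[simp] lemma pval_add (p q : MvPolynomial (Fin 2) ℝ) (x : Pt) :
    pval (p + q) x = pval p x + pval q x := map_add _ _ _

@[simp] lemma pval_mul (p q : MvPolynomial (Fin 2) ℝ) (x : Pt) :
    pval (p * q) x = pval p x * pval q x := map_mul _ _ _

@[simp] lemma pval_C (a : ℝ) (x : Pt) : pval (C a) x = a := eval_C _

@[simp] lemma pval_smul (a : ℝ) (p : MvPolynomial (Fin 2) ℝ) (x : Pt) :
    pval (a • p) x = a * pval p x := smul_eval _ _ _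

@[simp] lemma pval_sum {ι : Type*} (s : Finset ι) (p : ι → MvPolynomial (Fin 2) ℝ) (x : Pt) :
    pval (∑ i ∈ s, p i) x = ∑ i ∈ s, pval (p i) x := map_sum _ _ _

@[fun_prop]
lemma continuous_pval (p : MvPolynomial (Fin 2) ℝ) : Continuous (pval p) :=
  (continuous_eval p).comp (by fun_prop)

lemma pval_bind₁ (f : Fin 2 → MvPolynomial (Fin 2) ℝ) (p : MvPolynomial (Fin 2) ℝ) (x : Pt) :
    pval (bind₁ f p) x = pval p (WithLp.toLp 2 fun i => pval (f i) x) := by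
  simp only [pval, ← aeval_eq_eval, aeval_bind₁]

lemma mem_P : p ∈ P k ↔ p.totalDegree ≤ k := mem_restrictTotalDegree _ _ _

instance : FiniteDimensional ℝ (P k) := by unfold P; infer_instance

lemma C_mul_mem_P (hp : p ∈ P k) (a : ℝ) : C a * p ∈ P k := by
  rw [C_mul']
  exact (P k).smul_mem a hp

lemma bind₁_mem_P (hp : p ∈ P k) {f : Fin 2 → MvPolynomial (Fin 2) ℝ} (hf : ∀ i, f i ∈ P 1) :
    bind₁ f p ∈ P k :=
  mem_P.2 <| (totalDegree_bind₁_le (fun i => mem_P.1 (hf i)) p).trans (mem_P.1 hp)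

lemma mul_pderiv_mem_P {l : MvPolynomial (Fin 2) ℝ} (hl : l ∈ P 1) (hp : p ∈ P k) (j : Fin 2) :
    l * pderiv j p ∈ P k :=
  mem_P.2 <| (totalDegree_mul_pderiv_le (mem_P.1 hl) p j).trans (mem_P.1 hp)

/-- The polynomial with the same values as the affine function `f`. -/
noncomputable def affinePoly (f : Pt →ᵃ[ℝ] ℝ) : MvPolynomial (Fin 2) ℝ :=
  C (f 0) + ∑ j, C (f.linear (EuclideanSpace.single j 1)) * X j

lemma pval_affinePoly (f : Pt →ᵃ[ℝ] ℝ) (x : Pt) : pval (affinePoly f) x = f x := by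
  have hx : x = ∑ j, x j • EuclideanSpace.single j (1 : ℝ) := by
    ext i
    fin_cases i <;> simp [Fin.sum_univ_two]
  have hf : f x = f.linear x + f 0 := by simpa using f.map_vadd 0 x
  rw [hf]
  conv_rhs => rw [hx]
  simp [affinePoly, pval, add_comm, mul_comm]

lemma affinePoly_mem_P (f : Pt →ᵃ[ℝ] ℝ) : affinePoly f ∈ P 1 :=
  (P 1).add_mem (mem_P.2 (by simp)) <| (P 1).sum_mem fun j _ =>
    C_mul_mem_P (mem_P.2 (totalDegree_X j).le) _

/-- The composition `p ∘ F` of a polynomial with an affine map of the plane. -/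
noncomputable def compAffine (p : MvPolynomial (Fin 2) ℝ) (F : Pt →ᵃ[ℝ] Pt) :
    MvPolynomial (Fin 2) ℝ :=
  bind₁ (fun i => affinePoly ((EuclideanSpace.projₗ i).toAffineMap.comp F)) p

@[simp] lemma pval_compAffine (p : MvPolynomial (Fin 2) ℝ) (F : Pt →ᵃ[ℝ] Pt) (x : Pt) :
    pval (compAffine p F) x = pval p (F x) := by
  simp only [compAffine, pval_bind₁, pval_affinePoly]
  rfl

lemma compAffine_mem_P (hp : p ∈ P k) (F : Pt →ᵃ[ℝ] Pt) : compAffine p F ∈ P k :=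
  bind₁_mem_P hp fun _ => affinePoly_mem_P _

end PlanePolynomials

section DominatedForms

variable {V : Type*}

lemma exists_apply_self_le_mul_norm_sq [NormedAddCommGroup V] [NormedSpace ℝ V]
    [FiniteDimensional ℝ V] (B : V →ₗ[ℝ] V →ₗ[ℝ] ℝ) :
    ∃ C : ℝ, 0 < C ∧ ∀ x, B x x ≤ C * (‖x‖ * ‖x‖) := by
  let L := LinearMap.toContinuousBilinearMap B
  refine ⟨‖L‖ + 1, by positivity, fun x => ?_⟩
  calc B x x ≤ ‖L‖ * ‖x‖ * ‖x‖ := (le_abs_self _).trans (L.le_opNorm₂ x x)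
    _ ≤ (‖L‖ + 1) * (‖x‖ * ‖x‖) := by rw [mul_assoc]; gcongr; linarith

lemma exists_apply_self_le_mul_of_posDef [AddCommGroup V] [Module ℝ V]
    [hV : FiniteDimensional ℝ V] (B₁ B₂ : V →ₗ[ℝ] V →ₗ[ℝ] ℝ) (symm : ∀ x y, B₁ x y = B₁ y x)
    (nonneg : ∀ x, 0 ≤ B₁ x x) (definite : ∀ x, B₁ x x = 0 → x = 0) :
    ∃ C : ℝ, 0 < C ∧ ∀ x, B₂ x x ≤ C * B₁ x x := by
  let core : InnerProductSpace.Core ℝ V :=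
    { inner := fun x y => B₁ x y
      conj_inner_symm := fun x y => by simpa using symm y x
      re_inner_nonneg := fun x => by simpa using nonneg x
      add_left := fun x y z => by simp
      smul_left := fun x y r => by simp
      definite := definite }
  let N : NormedAddCommGroup V := core.toNormedAddCommGroup
  let I : InnerProductSpace ℝ V := InnerProductSpace.ofCore core.toCore
  obtain ⟨C, hC, hB⟩ := @exists_apply_self_le_mul_norm_sq V N I.toNormedSpace hV B₂
  refine ⟨C, hC, fun x => (hB x).trans_eq ?_⟩
  rw [← real_inner_self_eq_norm_mul_norm]
  rfl

end DominatedForms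

section WeightedIntegrals

variable {k : ℕ} {K U : Set Pt} {w : Pt → ℝ}

lemma eq_zero_of_forall_mem_isOpen {p : MvPolynomial (Fin 2) ℝ} (hU : IsOpen U)
    (hne : U.Nonempty) (h : ∀ x ∈ U, pval p x = 0) : p = 0 := by
  obtain ⟨x, hx⟩ := hne
  obtain ⟨r, hr, hball⟩ := Metric.isOpen_iff.1
    (hU.preimage (PiLp.continuous_toLp 2 fun _ : Fin 2 => ℝ)) x.ofLp hx
  refine funext_set (fun i => Metric.ball (x i) r)
    (fun i => by rw [Real.ball_eq_Ioo]; exact Set.Ioo_infinite (by linarith)) fun y hy => ?_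
  rw [map_zero]
  exact h (WithLp.toLp 2 y) (hball (by rwa [ball_pi _ hr]))

lemma eq_zero_of_setIntegral_mul_sq_eq_zero {p : MvPolynomial (Fin 2) ℝ} (hK : IsCompact K)
    (hw : Continuous w) (hwK : ∀ x ∈ K, 0 ≤ w x) (hU : IsOpen U) (hne : U.Nonempty) (hUK : U ⊆ K)
    (hwU : ∀ x ∈ U, 0 < w x) (h : ∫ x in K, w x * pval p x ^ 2 = 0) : p = 0 := by
  have hcont : Continuous fun x => w x * pval p x ^ 2 := by fun_prop
  have hae := (setIntegral_eq_zero_iff_of_nonneg_ae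
    ((ae_restrict_iff' hK.measurableSet).2 <| .of_forall fun x hx =>
      mul_nonneg (hwK x hx) (sq_nonneg _)) (hcont.continuousOn.integrableOn_compact hK)).1 h
  have hzero := Measure.eqOn_open_of_ae_eq (ae_restrict_of_ae_restrict_of_subset hUK hae) hU
    hcont.continuousOn continuousOn_const
  refine eq_zero_of_forall_mem_isOpen hU hne fun x hx => ?_
  exact pow_eq_zero_iff two_ne_zero |>.1 <| (mul_eq_zero.1 (hzero hx)).resolve_left (hwU x hx).ne'

/-- The bilinear form `∫_K w p q dx` on `P k`. -/
noncomputable def weightForm (k : ℕ) (hK : IsCompact K) (hw : Continuous w) :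
    P k →ₗ[ℝ] P k →ₗ[ℝ] ℝ :=
  have hint : ∀ p q : MvPolynomial (Fin 2) ℝ,
      Integrable (fun x => w x * (pval p x * pval q x)) (volume.restrict K) :=
    fun p q => Continuous.continuousOn (by fun_prop) |>.integrableOn_compact hK
  LinearMap.mk₂ ℝ (fun p q => ∫ x in K, w x * (pval p x * pval q x))
    (fun p q r => by
      simp only [Submodule.coe_add, pval_add, add_mul, mul_add, integral_add (hint _ _) (hint _ _)])
    (fun a p r => by
      simp only [Submodule.coe_smul, pval_smul, mul_assoc, mul_left_comm _ a, integral_const_mul,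
        smul_eq_mul])
    (fun p q r => by
      simp only [Submodule.coe_add, pval_add, mul_add, integral_add (hint _ _) (hint _ _)])
    (fun a p r => by
      simp only [Submodule.coe_smul, pval_smul, mul_left_comm _ a, integral_const_mul,
        smul_eq_mul])

lemma exists_setIntegral_sq_le (k : ℕ) (hK : IsCompact K) (hw : Continuous w)
    (hwK : ∀ x ∈ K, 0 ≤ w x) (hU : IsOpen U) (hne : U.Nonempty) (hUK : U ⊆ K)
    (hwU : ∀ x ∈ U, 0 < w x) : ∃ C : ℝ, 0 < C ∧ ∀ p ∈ P k,
      ∫ x in K, pval p x ^ 2 ≤ C * ∫ x in K, w x * pval p x ^ 2 := by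
  obtain ⟨C, hC, h⟩ := exists_apply_self_le_mul_of_posDef (weightForm k hK hw)
    (weightForm k hK (continuous_const (y := (1 : ℝ))))
    (fun p q => by simp only [weightForm, LinearMap.mk₂_apply, mul_comm])
    (fun p => setIntegral_nonneg hK.measurableSet fun x hx =>
      mul_nonneg (hwK x hx) (mul_self_nonneg _))
    (fun p hp => Subtype.ext <| eq_zero_of_setIntegral_mul_sq_eq_zero hK hw hwK hU hne hUK hwU <| by
      simpa only [weightForm, LinearMap.mk₂_apply, ← sq] using hp)
  exact ⟨C, hC, fun p hp => by
    simpa only [weightForm, LinearMap.mk₂_apply, one_mul, ← sq] using h ⟨p, hp⟩⟩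

end WeightedIntegrals

section ReferenceTriangle

/-- The closed triangle with vertices `0`, `e₀`, `e₁`. -/
def refTri : Set Pt := {x | 0 ≤ x 0 ∧ 0 ≤ x 1 ∧ x 0 + x 1 ≤ 1}

/-- The cubic bubble of `refTri`, which vanishes on its boundary. -/
def bubble (x : Pt) : ℝ := x 0 * x 1 * (1 - x 0 - x 1)

lemma isClosed_refTri : IsClosed refTri := by
  simp only [refTri, Set.ofPred_and]
  exact (isClosed_le (by fun_prop) (by fun_prop)).inter <|
    (isClosed_le (by fun_prop) (by fun_prop)).inter (isClosed_le (by fun_prop) (by fun_prop))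

lemma ofLp_mem_Icc_of_mem_refTri {x : Pt} (hx : x ∈ refTri) : x.ofLp ∈ Set.Icc 0 1 := by
  obtain ⟨h0, h1, h2⟩ := hx
  refine ⟨fun i => ?_, fun i => ?_⟩ <;> fin_cases i <;> simp <;> linarith

lemma isCompact_refTri : IsCompact refTri :=
  ((EuclideanSpace.equiv (Fin 2) ℝ).toHomeomorph.isClosedEmbedding.isCompact_preimage
    (isCompact_Icc (a := 0) (b := 1))).of_isClosed_subset isClosed_refTri
    fun _ => ofLp_mem_Icc_of_mem_refTri

lemma integrableOn_refTri {f : Pt → ℝ} (hf : Continuous f) : IntegrableOn f refTri :=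
  hf.continuousOn.integrableOn_compact isCompact_refTri

@[fun_prop]
lemma continuous_bubble : Continuous bubble := by unfold bubble; fun_prop

lemma bubble_nonneg {x : Pt} (hx : x ∈ refTri) : 0 ≤ bubble x :=
  mul_nonneg (mul_nonneg hx.1 hx.2.1) (by linarith [hx.2.2])

lemma exists_integral_sq_le_integral_bubble (k : ℕ) : ∃ C : ℝ, 0 < C ∧ ∀ p ∈ P k,
    ∫ x in refTri, pval p x ^ 2 ≤ C * ∫ x in refTri, bubble x * pval p x ^ 2 := by
  refine exists_setIntegral_sq_le k (U := {x | 0 < x 0} ∩ ({x | 0 < x 1} ∩ {x | x 0 + x 1 < 1}))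
    isCompact_refTri continuous_bubble (fun _ => bubble_nonneg) ?_ ?_ ?_ ?_
  · exact (isOpen_lt (by fun_prop) (by fun_prop)).inter <|
      (isOpen_lt (by fun_prop) (by fun_prop)).inter (isOpen_lt (by fun_prop) (by fun_prop))
  · exact ⟨!₂[1 / 4, 1 / 4], by norm_num⟩
  · exact fun x hx => ⟨hx.1.le, hx.2.1.le, hx.2.2.le⟩
  · exact fun x hx => mul_pos (mul_pos hx.1 hx.2.1)
      (by linarith [show x 0 + x 1 < 1 from hx.2.2])

lemma integral_Icc_comp_apply {ι : Type*} [Fintype ι] (i : ι) {g : ℝ → ℝ} (hg : Continuous g) :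
    ∫ x in Set.Icc (0 : ι → ℝ) 1, g (x i) = ∫ s in (0 : ℝ)..1, g s := by
  have : IsProbabilityMeasure (volume.restrict (Set.Icc (0 : ℝ) 1)) := ⟨by simp⟩
  rw [← Set.pi_univ_Icc, volume_pi, Measure.restrict_pi_pi,
    intervalIntegral.integral_of_le zero_le_one, ← integral_Icc_eq_integral_Ioc]
  exact integral_comp_eval (μ := fun _ : ι => volume.restrict (Set.Icc (0 : ℝ) 1)) (i := i)
    hg.aestronglyMeasurable

lemma integral_refTri_comp_apply_le {g : ℝ → ℝ} (hg : Continuous g) (hn : ∀ s, 0 ≤ g s)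
    (j : Fin 2) : ∫ x in refTri, g (x j) ≤ ∫ s in (0 : ℝ)..1, g s := by
  have hmp := PiLp.volume_preserving_ofLp (Fin 2)
  have hemb : MeasurableEmbedding (WithLp.ofLp : Pt → Fin 2 → ℝ) :=
    (MeasurableEquiv.toLp 2 (Fin 2 → ℝ)).symm.measurableEmbedding
  have hcont : Continuous fun y : Fin 2 → ℝ => g (y j) := by fun_prop
  calc ∫ x in refTri, g (x j) ≤ ∫ x in WithLp.ofLp ⁻¹' Set.Icc (0 : Fin 2 → ℝ) 1, g (x j) :=
        setIntegral_mono_set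
          ((hmp.integrableOn_comp_preimage hemb).2
            (hcont.continuousOn.integrableOn_compact isCompact_Icc))
          (.of_forall fun _ => hn _) (.of_forall fun _ => ofLp_mem_Icc_of_mem_refTri)
    _ = ∫ y in Set.Icc (0 : Fin 2 → ℝ) 1, g (y j) :=
        hmp.setIntegral_preimage_emb hemb (fun y => g (y j)) _
    _ = ∫ s in (0 : ℝ)..1, g s := integral_Icc_comp_apply j hg

end ReferenceTriangle

/-! ### Edge integrals and dual matrices -/

section EdgeIntegrals

lemma edgeSet_mk (a b : Pt) : edgeSet s(a, b) = segment ℝ a b := by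
  have hset : {x | x ∈ s(a, b)} = ({a, b} : Set Pt) := by
    ext
    simp
  rw [edgeSet, hset, convexHull_pair]

lemma lineMap_mem_edgeSet (a b : Pt) {s : ℝ} (hs : s ∈ Set.Icc (0 : ℝ) 1) :
    AffineMap.lineMap a b s ∈ edgeSet s(a, b) := by
  rw [edgeSet_mk, segment_eq_image_lineMap]
  exact Set.mem_image_of_mem _ hs

lemma edgeIntegral_mk (f : Pt → ℝ) (a b : Pt) :
    edgeIntegral f s(a, b) = dist a b * ∫ s in (0 : ℝ)..1, f (AffineMap.lineMap a b s) := rfl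

lemma edgeLength_mk (a b : Pt) : edgeLength s(a, b) = dist a b := rfl

variable {f g : Pt → ℝ} (e : Sym2 Pt)

lemma edgeLength_nonneg : 0 ≤ edgeLength e := by
  induction e using Sym2.ind with
  | _ a b => exact dist_nonneg (x := a) (y := b)

variable {e} in
lemma edgeIntegral_congr (h : ∀ x ∈ edgeSet e, f x = g x) :
    edgeIntegral f e = edgeIntegral g e := by
  induction e using Sym2.ind with
  | _ a b =>
    rw [edgeIntegral_mk, edgeIntegral_mk]
    congr 1
    refine intervalIntegral.integral_congr fun s hs => h _ (lineMap_mem_edgeSet a b ?_)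
    rwa [Set.uIcc_of_le zero_le_one] at hs

lemma edgeIntegral_const (r : ℝ) : edgeIntegral (fun _ => r) e = edgeLength e * r := by
  induction e using Sym2.ind with
  | _ a b => simp [edgeIntegral_mk, edgeLength_mk]

lemma edgeIntegral_const_mul (r : ℝ) (f : Pt → ℝ) :
    edgeIntegral (fun x => r * f x) e = r * edgeIntegral f e := by
  induction e using Sym2.ind with
  | _ a b => rw [edgeIntegral_mk, edgeIntegral_mk, intervalIntegral.integral_const_mul]; ring

lemma edgeIntegral_add (hf : Continuous f) (hg : Continuous g) :
    edgeIntegral (fun x => f x + g x) e = edgeIntegral f e + edgeIntegral g e := by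
  induction e using Sym2.ind with
  | _ a b =>
    have hline : Continuous fun s : ℝ => (AffineMap.lineMap a b s : Pt) :=
      AffineMap.lineMap_continuous
    have hadd := intervalIntegral.integral_add (μ := volume)
      ((hf.comp hline).intervalIntegrable 0 1) ((hg.comp hline).intervalIntegrable 0 1)
    simp only [Function.comp_apply] at hadd
    rw [edgeIntegral_mk, edgeIntegral_mk, edgeIntegral_mk, hadd, mul_add]

lemma edgeIntegral_nonneg (h : ∀ x, 0 ≤ f x) : 0 ≤ edgeIntegral f e := by
  induction e using Sym2.ind with
  | _ a b =>
    exact mul_nonneg dist_nonneg (intervalIntegral.integral_nonneg zero_le_one fun _ _ => h _)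

end EdgeIntegrals

section PlaneVectors

variable (n a b : Fin 2 → ℝ)

/-- The rotation by a right angle; it sends the unit normal of an edge to its unit tangent. -/
def perp : Fin 2 → ℝ := ![-n 1, n 0]

/-- The determinant of two plane vectors. -/
def det₂ : ℝ := a 0 * b 1 - a 1 * b 0

lemma perp_dot_perp : perp a ⬝ᵥ perp b = a ⬝ᵥ b := by
  simp only [perp, dotProduct, Fin.sum_univ_two, Matrix.cons_val_zero, Matrix.cons_val_one]
  ring

lemma dotProduct_self_nonneg {ι : Type*} [Fintype ι] (a : ι → ℝ) : 0 ≤ a ⬝ᵥ a :=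
  Finset.sum_nonneg fun _ _ => mul_self_nonneg _

lemma dotProduct_sq_le {ι : Type*} [Fintype ι] (a b : ι → ℝ) :
    (a ⬝ᵥ b) ^ 2 ≤ (a ⬝ᵥ a) * (b ⬝ᵥ b) := by
  simpa only [dotProduct, ← sq] using Finset.sum_mul_sq_le_sq_mul_sq Finset.univ a b

lemma dotProduct_ofLp_self {ι : Type*} [Fintype ι] (x : EuclideanSpace ℝ ι) :
    x.ofLp ⬝ᵥ x.ofLp = ‖x‖ ^ 2 := by
  rw [EuclideanSpace.real_norm_sq_eq]
  simp only [dotProduct, sq]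

lemma sq_det₂_of_dotProduct_eq_zero {n a : Fin 2 → ℝ} (hn : n ⬝ᵥ n = 1) (ha : n ⬝ᵥ a = 0)
    (b : Fin 2 → ℝ) : det₂ a b ^ 2 = (a ⬝ᵥ a) * (n ⬝ᵥ b) ^ 2 := by
  simp only [dotProduct, Fin.sum_univ_two] at hn ha
  have ha₀ : a 0 = n 1 * (n 1 * a 0 - n 0 * a 1) := by
    linear_combination -a 0 * hn + n 0 * ha
  have ha₁ : a 1 = -n 0 * (n 1 * a 0 - n 0 * a 1) := by
    linear_combination -a 1 * hn + n 1 * ha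
  generalize n 1 * a 0 - n 0 * a 1 = t at ha₀ ha₁
  simp only [dotProduct, Fin.sum_univ_two, det₂, ha₀, ha₁]
  linear_combination -t ^ 2 * (n 0 * b 0 + n 1 * b 1) ^ 2 * hn

lemma sq_apply_le_dotProduct_self {ι : Type*} [Fintype ι] (a : ι → ℝ) (i : ι) :
    a i ^ 2 ≤ a ⬝ᵥ a := by
  rw [sq]
  exact Finset.single_le_sum (f := fun i => a i * a i) (fun _ _ => mul_self_nonneg _)
    (Finset.mem_univ i)

end PlaneVectors

section Frobenius

variable {ι : Type*} [Fintype ι] (X Y : Matrix (Fin 2) (Fin 2) ℝ)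

lemma frob_self_nonneg : 0 ≤ frob X X :=
  Finset.sum_nonneg fun _ _ => Finset.sum_nonneg fun _ _ => mul_self_nonneg _

lemma frob_sq_le : frob X Y ^ 2 ≤ frob X X * frob Y Y := by
  simpa only [frob, ← Fintype.sum_prod_type', sq] using Finset.sum_mul_sq_le_sq_mul_sq
    Finset.univ (fun ij : Fin 2 × Fin 2 => X ij.1 ij.2) fun ij => Y ij.1 ij.2

lemma sq_apply_le_frob_self (i j : Fin 2) : X i j ^ 2 ≤ frob X X :=
  (sq_apply_le_dotProduct_self (X i) j).trans <| Finset.single_le_sum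
    (f := fun i => X i ⬝ᵥ X i) (fun i _ => dotProduct_self_nonneg (X i)) (Finset.mem_univ i)

lemma frob_sum_smul_left (f : ι → ℝ) (X : ι → Matrix (Fin 2) (Fin 2) ℝ) :
    frob (∑ m, f m • X m) Y = ∑ m, f m * frob (X m) Y := by
  simp only [frob, Matrix.sum_apply, Matrix.smul_apply, smul_eq_mul, Finset.sum_mul,
    Finset.mul_sum, mul_assoc]
  rw [Finset.sum_comm]
  simp only [Finset.sum_comm (s := Finset.univ (α := ι))]
  rw [Finset.sum_comm]

lemma frob_sum_smul_self_le (f : ι → ℝ) (X : ι → Matrix (Fin 2) (Fin 2) ℝ) :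
    frob (∑ m, f m • X m) (∑ m, f m • X m) ≤ (∑ m, f m ^ 2) * ∑ m, frob (X m) (X m) := by
  have hentry : ∀ i j, (∑ m, f m • X m) i j * (∑ m, f m • X m) i j ≤
      (∑ m, f m ^ 2) * ∑ m, X m i j * X m i j := fun i j => by
    simpa only [Matrix.sum_apply, Matrix.smul_apply, smul_eq_mul, sq] using
      Finset.sum_mul_sq_le_sq_mul_sq Finset.univ f fun m => X m i j
  calc _ ≤ ∑ i, ∑ j, (∑ m, f m ^ 2) * ∑ m, X m i j * X m i j :=
        Finset.sum_le_sum fun i _ => Finset.sum_le_sum fun j _ => hentry i j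
    _ = _ := by
        simp only [← Finset.mul_sum, frob, Fin.sum_univ_two, Finset.sum_add_distrib]

lemma frob_vecMulVec_self (a b : Fin 2 → ℝ) :
    frob (Matrix.vecMulVec a b) (Matrix.vecMulVec a b) = (a ⬝ᵥ a) * (b ⬝ᵥ b) := by
  simp only [frob, Fin.sum_univ_two, Matrix.vecMulVec_apply, dotProduct]
  ring

lemma frob_smul_self (r : ℝ) : frob (r • X) (r • X) = r ^ 2 * frob X X := by
  simp only [frob, Fin.sum_univ_two, Matrix.smul_apply, smul_eq_mul]
  ring

lemma mulVec_dot_self_le {n : Fin 2 → ℝ} (hn : n ⬝ᵥ n = 1) :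
    (X *ᵥ n) ⬝ᵥ (X *ᵥ n) ≤ frob X X :=
  Finset.sum_le_sum fun i _ => by
    rw [← sq]
    exact (dotProduct_sq_le (X i) n).trans_eq (by rw [hn, mul_one]; rfl)

lemma perp_dot_mulVec_sq_le {n : Fin 2 → ℝ} (hn : n ⬝ᵥ n = 1) :
    (perp n ⬝ᵥ (X *ᵥ n)) ^ 2 ≤ frob X X :=
  calc _ ≤ (perp n ⬝ᵥ perp n) * ((X *ᵥ n) ⬝ᵥ (X *ᵥ n)) := dotProduct_sq_le _ _
    _ ≤ frob X X := by
      rw [perp_dot_perp, hn, one_mul]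
      exact mulVec_dot_self_le X hn

end Frobenius

section DualMatrices

/-- The degrees of freedom of a constant matrix `X` on a triangle with unit normals `n₀`, `n₁`,
`n₂`: both components of the trace `X n₀`, and the tangential components of `X n₁` and `X n₂`. -/
def dualFun (n₀ n₁ n₂ : Fin 2 → ℝ) : Matrix (Fin 2) (Fin 2) ℝ →ₗ[ℝ] Fin 4 → ℝ where
  toFun X := ![(X *ᵥ n₀) 0, (X *ᵥ n₀) 1, perp n₁ ⬝ᵥ (X *ᵥ n₁), perp n₂ ⬝ᵥ (X *ᵥ n₂)]
  map_add' X Y := by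
    simp only [Matrix.add_mulVec, dotProduct_add, Pi.add_apply]
    ext m
    fin_cases m <;> rfl
  map_smul' r X := by
    simp only [Matrix.smul_mulVec, dotProduct_smul, Pi.smul_apply]
    ext m
    fin_cases m <;> rfl

lemma dualFun_apply (n₀ n₁ n₂ : Fin 2 → ℝ) (X : Matrix (Fin 2) (Fin 2) ℝ) :
    dualFun n₀ n₁ n₂ X =
      ![(X *ᵥ n₀) 0, (X *ᵥ n₀) 1, perp n₁ ⬝ᵥ (X *ᵥ n₁), perp n₂ ⬝ᵥ (X *ᵥ n₂)] := rfl

/-- The rank-one matrix attached to the edge `b` of the triangle with vertices `0`, `a`, `b`, where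
`n` is normal to `b`: of the degrees of freedom of the triangle only the tangential trace on that
edge is nonzero on it. -/
noncomputable def cornerMatrix (n a b : Fin 2 → ℝ) : Matrix (Fin 2) (Fin 2) ℝ :=
  ((n ⬝ᵥ a) ^ 2)⁻¹ • Matrix.vecMulVec (perp a) (a - b)

/-- The matrix `e_i ⊗ n₀`, corrected by corner matrices so that its tangential traces on the edges
`A` and `B` vanish. -/
noncomputable def sideMatrix (n₀ n₁ n₂ A B : Fin 2 → ℝ) (i : Fin 2) : Matrix (Fin 2) (Fin 2) ℝ :=
  ∑ m, ![1, -(perp n₁ i * (n₀ ⬝ᵥ n₁)), -(perp n₂ i * (n₀ ⬝ᵥ n₂))] m •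
    ![Matrix.vecMulVec (Pi.single i 1) n₀, cornerMatrix n₁ B A, cornerMatrix n₂ A B] m

/-- The family dual to `dualFun n₀ n₁ n₂` on the triangle with vertices `0`, `A`, `B`. -/
noncomputable def dualMatrix (n₀ n₁ n₂ A B : Fin 2 → ℝ) : Fin 4 → Matrix (Fin 2) (Fin 2) ℝ :=
  ![sideMatrix n₀ n₁ n₂ A B 0, sideMatrix n₀ n₁ n₂ A B 1, cornerMatrix n₁ B A, cornerMatrix n₂ A B]

lemma sum_dualFun_sq_le {n₀ n₁ n₂ : Fin 2 → ℝ} (h₀ : n₀ ⬝ᵥ n₀ = 1) (h₁ : n₁ ⬝ᵥ n₁ = 1)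
    (h₂ : n₂ ⬝ᵥ n₂ = 1) (X : Matrix (Fin 2) (Fin 2) ℝ) :
    ∑ m, dualFun n₀ n₁ n₂ X m ^ 2 ≤ 3 * frob X X := by
  have hside : (X *ᵥ n₀) 0 ^ 2 + (X *ᵥ n₀) 1 ^ 2 ≤ frob X X := by
    simpa only [dotProduct, Fin.sum_univ_two, ← sq] using mulVec_dot_self_le X h₀
  have h_edge₁ := perp_dot_mulVec_sq_le X h₁
  have h_edge₂ := perp_dot_mulVec_sq_le X h₂
  simp only [dualFun_apply, Fin.sum_univ_four, Matrix.cons_val]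
  linarith

section Corner

variable {m n a b : Fin 2 → ℝ}

lemma cornerMatrix_mulVec (n a b m : Fin 2 → ℝ) :
    cornerMatrix n a b *ᵥ m = (((n ⬝ᵥ a) ^ 2)⁻¹ * (m ⬝ᵥ (a - b))) • perp a := by
  rw [cornerMatrix, Matrix.smul_mulVec, Matrix.vecMulVec_mulVec, dotProduct_comm (a - b), mul_smul,
    op_smul_eq_smul]

lemma cornerMatrix_mulVec_eq_zero (h : m ⬝ᵥ (a - b) = 0) : cornerMatrix n a b *ᵥ m = 0 := by
  rw [cornerMatrix_mulVec, h, mul_zero, zero_smul]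

lemma perp_dot_cornerMatrix_mulVec_eq_zero (h : m ⬝ᵥ a = 0) :
    perp m ⬝ᵥ (cornerMatrix n a b *ᵥ m) = 0 := by
  rw [cornerMatrix_mulVec, dotProduct_smul, perp_dot_perp, h, smul_zero]

lemma perp_dot_cornerMatrix_mulVec_self (hb : n ⬝ᵥ b = 0) (ha : n ⬝ᵥ a ≠ 0) :
    perp n ⬝ᵥ (cornerMatrix n a b *ᵥ n) = 1 := by
  rw [cornerMatrix_mulVec, dotProduct_smul, perp_dot_perp, dotProduct_sub, hb, sub_zero,
    smul_eq_mul]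
  field_simp

lemma frob_cornerMatrix_self_le {h κ : ℝ} (hh : 0 < h) (hκ : 0 < κ) (ha : a ⬝ᵥ a ≤ h ^ 2)
    (hab : (a - b) ⬝ᵥ (a - b) ≤ h ^ 2) (height : κ * h ≤ |n ⬝ᵥ a|) :
    frob (cornerMatrix n a b) (cornerMatrix n a b) ≤ (κ ^ 4)⁻¹ := by
  have hpow : (κ * h) ^ 4 ≤ (n ⬝ᵥ a) ^ 4 := by
    rw [← (by decide : Even 4).pow_abs (n ⬝ᵥ a)]
    gcongr
  calc frob (cornerMatrix n a b) (cornerMatrix n a b)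
      = ((n ⬝ᵥ a) ^ 4)⁻¹ * ((a ⬝ᵥ a) * ((a - b) ⬝ᵥ (a - b))) := by
        rw [cornerMatrix, frob_smul_self, frob_vecMulVec_self, perp_dot_perp, inv_pow, ← pow_mul]
    _ ≤ ((κ * h) ^ 4)⁻¹ * (h ^ 2 * h ^ 2) := by
        have := mul_nonneg (dotProduct_self_nonneg a) (dotProduct_self_nonneg (a - b))
        have := dotProduct_self_nonneg (a - b)
        gcongr
    _ = (κ ^ 4)⁻¹ := by field_simp

end Corner

/-- Quantitative shape regularity of the triangle with vertices `0`, `A`, `B` and unit normals `n₀`,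
`n₁`, `n₂` on its edges `AB`, `0A` and `0B`: its edges are at most `h` long, and its heights on the
edges `0A` and `0B` are at least `κ h`. -/
structure ShapeRegular (n₀ n₁ n₂ A B : Fin 2 → ℝ) (h κ : ℝ) : Prop where
  h_pos : 0 < h
  κ_pos : 0 < κ
  unit₀ : n₀ ⬝ᵥ n₀ = 1
  unit₁ : n₁ ⬝ᵥ n₁ = 1
  unit₂ : n₂ ⬝ᵥ n₂ = 1
  orth₀ : n₀ ⬝ᵥ (B - A) = 0
  orth₁ : n₁ ⬝ᵥ A = 0
  orth₂ : n₂ ⬝ᵥ B = 0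
  len₀ : (B - A) ⬝ᵥ (B - A) ≤ h ^ 2
  len₁ : A ⬝ᵥ A ≤ h ^ 2
  len₂ : B ⬝ᵥ B ≤ h ^ 2
  height₁ : κ * h ≤ |n₁ ⬝ᵥ B|
  height₂ : κ * h ≤ |n₂ ⬝ᵥ A|

/-- The bound on the squared Frobenius norms of the dual matrices of a triangle of shape `κ`. -/
noncomputable def dualBound (κ : ℝ) : ℝ := 3 * (1 + 2 * (κ ^ 4)⁻¹)

lemma dualBound_pos {κ : ℝ} (hκ : 0 < κ) : 0 < dualBound κ := by
  unfold dualBound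
  positivity

namespace ShapeRegular

variable {n₀ n₁ n₂ A B : Fin 2 → ℝ} {h κ : ℝ} (hS : ShapeRegular n₀ n₁ n₂ A B h κ)
include hS

lemma dot_ne_zero₁ : n₁ ⬝ᵥ B ≠ 0 := abs_pos.1 ((mul_pos hS.κ_pos hS.h_pos).trans_le hS.height₁)

lemma dot_ne_zero₂ : n₂ ⬝ᵥ A ≠ 0 := abs_pos.1 ((mul_pos hS.κ_pos hS.h_pos).trans_le hS.height₂)

lemma orth₀' : n₀ ⬝ᵥ (A - B) = 0 := by rw [← neg_sub, dotProduct_neg, hS.orth₀, neg_zero]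

lemma dualFun_cornerMatrix₁ : dualFun n₀ n₁ n₂ (cornerMatrix n₁ B A) = Pi.single 2 1 := by
  have h₀ := cornerMatrix_mulVec_eq_zero (n := n₁) hS.orth₀
  have h₁ := perp_dot_cornerMatrix_mulVec_self hS.orth₁ hS.dot_ne_zero₁
  have h₂ := perp_dot_cornerMatrix_mulVec_eq_zero (n := n₁) (b := A) hS.orth₂
  rw [dualFun_apply, h₀, h₁, h₂]
  ext m
  fin_cases m <;> simp

lemma dualFun_cornerMatrix₂ : dualFun n₀ n₁ n₂ (cornerMatrix n₂ A B) = Pi.single 3 1 := by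
  have h₀ := cornerMatrix_mulVec_eq_zero (n := n₂) hS.orth₀'
  have h₁ := perp_dot_cornerMatrix_mulVec_eq_zero (n := n₂) (b := B) hS.orth₁
  have h₂ := perp_dot_cornerMatrix_mulVec_self hS.orth₂ hS.dot_ne_zero₂
  rw [dualFun_apply, h₀, h₁, h₂]
  ext m
  fin_cases m <;> simp

lemma dualFun_sideMatrix (i : Fin 2) :
    dualFun n₀ n₁ n₂ (sideMatrix n₀ n₁ n₂ A B i) = Pi.single (Fin.castLE (by norm_num) i) 1 := by
  have hrank : dualFun n₀ n₁ n₂ (Matrix.vecMulVec (Pi.single i 1) n₀) =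
      ![(Pi.single i 1 : Fin 2 → ℝ) 0, (Pi.single i 1 : Fin 2 → ℝ) 1,
        perp n₁ i * (n₀ ⬝ᵥ n₁), perp n₂ i * (n₀ ⬝ᵥ n₂)] := by
    simp only [dualFun_apply, Matrix.vecMulVec_mulVec, hS.unit₀, op_smul_eq_smul, one_smul,
      dotProduct_smul, dotProduct_single, mul_one, smul_eq_mul, mul_comm (n₀ ⬝ᵥ _)]
  simp only [sideMatrix, Fin.sum_univ_three, map_add, map_smul, Matrix.cons_val,
    hrank, hS.dualFun_cornerMatrix₁, hS.dualFun_cornerMatrix₂]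
  ext m
  simp only [Pi.add_apply, Pi.smul_apply, smul_eq_mul]
  fin_cases i <;> fin_cases m <;> simp

lemma dualFun_dualMatrix (m : Fin 4) :
    dualFun n₀ n₁ n₂ (dualMatrix n₀ n₁ n₂ A B m) = Pi.single m 1 := by
  fin_cases m
  · exact hS.dualFun_sideMatrix 0
  · exact hS.dualFun_sideMatrix 1
  · exact hS.dualFun_cornerMatrix₁
  · exact hS.dualFun_cornerMatrix₂

lemma dualFun_sum_dualMatrix (f : Fin 4 → ℝ) :
    dualFun n₀ n₁ n₂ (∑ m, f m • dualMatrix n₀ n₁ n₂ A B m) = f := by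
  simp only [map_sum, map_smul, hS.dualFun_dualMatrix]
  exact (pi_eq_sum_univ' f).symm

lemma sum_dualFun_smul_dualMatrix (H : Matrix (Fin 2) (Fin 2) ℝ) :
    ∑ m, dualFun n₀ n₁ n₂ H m • dualMatrix n₀ n₁ n₂ A B m = H := by
  have hsurj : Function.Surjective (dualFun n₀ n₁ n₂) :=
    fun f => ⟨_, hS.dualFun_sum_dualMatrix f⟩
  have hinj := (LinearMap.injective_iff_surjective_of_finrank_eq_finrank
    (by simp [Module.finrank_matrix])).2 hsurj
  exact hinj (hS.dualFun_sum_dualMatrix _)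

lemma frob_cornerMatrix₁_le : frob (cornerMatrix n₁ B A) (cornerMatrix n₁ B A) ≤ (κ ^ 4)⁻¹ :=
  frob_cornerMatrix_self_le hS.h_pos hS.κ_pos hS.len₂ hS.len₀ hS.height₁

lemma frob_cornerMatrix₂_le : frob (cornerMatrix n₂ A B) (cornerMatrix n₂ A B) ≤ (κ ^ 4)⁻¹ := by
  refine frob_cornerMatrix_self_le hS.h_pos hS.κ_pos hS.len₁ ?_ hS.height₂
  rw [← neg_sub, neg_dotProduct_neg]
  exact hS.len₀

lemma frob_sideMatrix_le (i : Fin 2) :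
    frob (sideMatrix n₀ n₁ n₂ A B i) (sideMatrix n₀ n₁ n₂ A B i) ≤ dualBound κ := by
  have hcoef : ∀ n : Fin 2 → ℝ, n ⬝ᵥ n = 1 → (perp n i * (n₀ ⬝ᵥ n)) ^ 2 ≤ 1 := fun n hn => by
    have hperp := sq_apply_le_dotProduct_self (perp n) i
    have hdot := dotProduct_sq_le n₀ n
    rw [perp_dot_perp, hn] at hperp
    rw [hS.unit₀, hn, one_mul] at hdot
    rw [mul_pow]
    exact mul_le_one₀ hperp (sq_nonneg _) hdot
  have hrank : frob (Matrix.vecMulVec (Pi.single i 1) n₀) (Matrix.vecMulVec (Pi.single i 1) n₀)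
      = 1 := by
    rw [frob_vecMulVec_self, hS.unit₀, single_dotProduct, Pi.single_eq_same]
    norm_num
  refine (frob_sum_smul_self_le _ _).trans ?_
  simp only [dualBound, Fin.sum_univ_three, Matrix.cons_val, hrank, one_pow, neg_sq]
  have := hS.frob_cornerMatrix₁_le
  have := hS.frob_cornerMatrix₂_le
  have := frob_self_nonneg (cornerMatrix n₁ B A)
  have := frob_self_nonneg (cornerMatrix n₂ A B)
  have := hcoef n₁ hS.unit₁
  have := hcoef n₂ hS.unit₂
  exact mul_le_mul (by linarith) (by linarith) (by linarith) (by norm_num)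

lemma frob_dualMatrix_le (m : Fin 4) :
    frob (dualMatrix n₀ n₁ n₂ A B m) (dualMatrix n₀ n₁ n₂ A B m) ≤ dualBound κ := by
  have hcorner : (κ ^ 4)⁻¹ ≤ dualBound κ := by
    have := inv_nonneg.2 (pow_nonneg hS.κ_pos.le 4)
    unfold dualBound
    linarith
  fin_cases m
  · exact hS.frob_sideMatrix_le 0
  · exact hS.frob_sideMatrix_le 1
  · exact hS.frob_cornerMatrix₁_le.trans hcorner
  · exact hS.frob_cornerMatrix₂_le.trans hcorner

lemma frob_self_le_sum_frob_dualMatrix_sq (H : Matrix (Fin 2) (Fin 2) ℝ) :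
    frob H H ≤ 3 * ∑ m, frob (dualMatrix n₀ n₁ n₂ A B m) H ^ 2 := by
  have hexpand : frob H H =
      ∑ m, dualFun n₀ n₁ n₂ H m * frob (dualMatrix n₀ n₁ n₂ A B m) H := by
    rw [← frob_sum_smul_left, hS.sum_dualFun_smul_dualMatrix]
  have hsq : frob H H * frob H H ≤
      3 * (∑ m, frob (dualMatrix n₀ n₁ n₂ A B m) H ^ 2) * frob H H :=
    calc frob H H * frob H H
        ≤ (∑ m, dualFun n₀ n₁ n₂ H m ^ 2) * ∑ m, frob (dualMatrix n₀ n₁ n₂ A B m) H ^ 2 := by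
          rw [← sq]
          conv_lhs => rw [hexpand]
          exact Finset.sum_mul_sq_le_sq_mul_sq _ _ _
      _ ≤ (3 * frob H H) * ∑ m, frob (dualMatrix n₀ n₁ n₂ A B m) H ^ 2 := by
          have := sum_dualFun_sq_le hS.unit₀ hS.unit₁ hS.unit₂ H
          gcongr
      _ = _ := by ring
  rcases (frob_self_nonneg H).eq_or_lt with h0 | h0
  · rw [← h0]
    positivity
  · exact le_of_mul_le_mul_right hsq h0

end ShapeRegular

end DualMatrices

/-! ### Integrals over triangles -/

section TriangleIntegrals

/-- The linear map with columns `a` and `b`. -/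
noncomputable def columnMap (a b : Pt) : Pt →L[ℝ] Pt :=
  (EuclideanSpace.proj (𝕜 := ℝ) (0 : Fin 2)).smulRight a +
    (EuclideanSpace.proj (𝕜 := ℝ) (1 : Fin 2)).smulRight b

lemma columnMap_apply (a b x : Pt) : columnMap a b x = x 0 • a + x 1 • b := rfl

lemma det_columnMap (a b : Pt) : (columnMap a b).det = det₂ a.ofLp b.ofLp := by
  rw [ContinuousLinearMap.det,
    ← LinearMap.det_toMatrix (EuclideanSpace.basisFun (Fin 2) ℝ).toBasis, Matrix.det_fin_two]
  simp [LinearMap.toMatrix_apply, columnMap_apply, det₂]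
  ring

/-- The affine map from the reference triangle onto the triangle with vertices `p`, `q`, `r`. -/
noncomputable def refMap (p q r : Pt) : Pt →ᵃ[ℝ] Pt :=
  (columnMap (q - p) (r - p) : Pt →ₗ[ℝ] Pt).toAffineMap + AffineMap.const ℝ Pt p

variable (p q r : Pt)

lemma refMap_eq_columnMap_add (x : Pt) :
    refMap p q r x = columnMap (q - p) (r - p) x + p := rfl

lemma refMap_eq_sum (x : Pt) :
    refMap p q r x = (1 - x 0 - x 1) • p + x 0 • q + x 1 • r := by
  rw [refMap_eq_columnMap_add, columnMap_apply]
  module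

lemma apply_refMap (f : Pt →ᵃ[ℝ] ℝ) (x : Pt) :
    f (refMap p q r x) = (1 - x 0 - x 1) * f p + x 0 * f q + x 1 * f r := by
  have hvadd : refMap p q r x = columnMap (q -ᵥ p) (r -ᵥ p) x +ᵥ p := rfl
  rw [hvadd, f.map_vadd, columnMap_apply, map_add, map_smul, map_smul, f.linearMap_vsub,
    f.linearMap_vsub]
  simp only [smul_eq_mul, vadd_eq_add, vsub_eq_sub]
  ring

lemma convex_refTri : Convex ℝ refTri := by
  rintro x ⟨hx₀, hx₁, hx⟩ y ⟨hy₀, hy₁, hy⟩ a b ha hb hab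
  refine ⟨?_, ?_, ?_⟩ <;> simp only [PiLp.add_apply, PiLp.smul_apply, smul_eq_mul]
  · positivity
  · positivity
  · nlinarith

lemma convexHull_eq_image_refTri : convexHull ℝ {p, q, r} = refMap p q r '' refTri := by
  apply Set.Subset.antisymm
  · refine convexHull_min ?_ (convex_refTri.affine_image _)
    rintro x (rfl | rfl | rfl)
    · exact ⟨0, by simp [refTri], by simp [refMap_eq_sum]⟩
    · exact ⟨!₂[1, 0], by simp [refTri], by simp [refMap_eq_sum]⟩
    · exact ⟨!₂[0, 1], by simp [refTri], by simp [refMap_eq_sum]⟩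
  · rintro _ ⟨x, ⟨hx₀, hx₁, hx⟩, rfl⟩
    have hcomb := (convex_convexHull ℝ ({p, q, r} : Set Pt)).sum_mem (t := Finset.univ)
      (w := ![1 - x 0 - x 1, x 0, x 1]) (z := ![p, q, r])
      (fun i _ => by fin_cases i <;> simp <;> linarith) (by simp [Fin.sum_univ_three]; ring)
      (fun i _ => subset_convexHull ℝ _ (by fin_cases i <;> simp))
    rw [refMap_eq_sum]
    simpa only [Fin.sum_univ_three, Matrix.cons_val] using hcomb

variable {p q r}

lemma injective_refMap (hdet : det₂ (q - p).ofLp (r - p).ofLp ≠ 0) :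
    Function.Injective (refMap p q r) := by
  rw [← det_columnMap] at hdet
  exact (add_left_injective p).comp
    ((columnMap (q - p) (r - p)).toContinuousLinearEquivOfDetNeZero hdet).injective

lemma integral_convexHull (hdet : det₂ (q - p).ofLp (r - p).ofLp ≠ 0) (f : Pt → ℝ) :
    ∫ x in convexHull ℝ {p, q, r}, f x =
      |det₂ (q - p).ofLp (r - p).ofLp| * ∫ x in refTri, f (refMap p q r x) := by
  rw [convexHull_eq_image_refTri, integral_image_eq_integral_abs_det_fderiv_smul volume
    isClosed_refTri.measurableSet (f := refMap p q r)
    (f' := fun _ => columnMap (q - p) (r - p))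
    (fun x _ => ((columnMap (q - p) (r - p)).hasFDerivAt.add_const p).hasFDerivWithinAt)
    (injective_refMap hdet).injOn, ← det_columnMap, ← integral_const_mul]
  rfl

end TriangleIntegrals

/-! ### Local geometry of a mesh -/

lemma eventually_lineMap_mem {x : Pt} {s : Set Pt} (hs : s ∈ 𝓝 x) (y : Pt) :
    ∀ᶠ ε in 𝓝[>] (0 : ℝ), AffineMap.lineMap x y ε ∈ s := by
  have hcont : Continuous fun ε : ℝ => (AffineMap.lineMap x y ε : Pt) :=
    AffineMap.lineMap_continuous
  have hs' : s ∈ 𝓝 (AffineMap.lineMap x y (0 : ℝ)) := by rwa [AffineMap.lineMap_apply_zero]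
  exact nhdsWithin_le_nhds (hcont.continuousAt.eventually hs')

namespace MeshData

variable {M : MeshData} {Ω : Set Pt} {τ τ' : M.Tri} {i j : Fin 3} {x : Pt}

/-- The vertices of a triangle, numbered so that the vertex `0` is the interior point of the
cell. -/
def vert (τ : M.Tri) : Fin 3 → Pt := ![M.vc τ, M.va τ, M.vb τ]

/-- The edge of a triangle opposite to its vertex `i`; the edge `0` is the side of the cell. -/
def edge (τ : M.Tri) (i : Fin 3) : Sym2 Pt := s(vert τ (i + 1), vert τ (i + 2))

lemma range_vert (τ : M.Tri) : Set.range (vert τ) = M.triVerts τ := by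
  rw [vert, Matrix.range_cons, Matrix.range_cons, Matrix.range_cons, Matrix.range_empty,
    Set.union_empty]
  rfl

lemma vert_mem_triVerts (τ : M.Tri) (i : Fin 3) : vert τ i ∈ M.triVerts τ :=
  range_vert τ ▸ Set.mem_range_self i

lemma triVerts_subset_triSet (τ : M.Tri) : M.triVerts τ ⊆ M.triSet τ :=
  subset_convexHull ℝ _

lemma isCompact_triSet (τ : M.Tri) : IsCompact (M.triSet τ) :=
  Set.Finite.isCompact_convexHull ℝ (range_vert τ ▸ Set.finite_range _)

lemma edge_one (τ : M.Tri) : edge τ 1 = s(M.vc τ, M.vb τ) := Sym2.eq_swap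

lemma triEdges_eq_image [DecidableEq (Sym2 Pt)] (τ : M.Tri) :
    M.triEdges τ = Finset.univ.image (edge τ) := by
  ext e
  simp only [triEdges, Finset.mem_insert, Finset.mem_singleton, Finset.mem_image,
    Finset.mem_univ, true_and, Fin.exists_fin_succ, IsEmpty.exists_iff, or_false, eq_comm (b := e)]
  rw [← edge_one, or_comm (a := e = s(M.vc τ, M.va τ))]
  rfl

lemma mem_adj {e : Sym2 Pt} : τ ∈ M.adj e ↔ ∃ i, edge τ i = e := by
  classical
  simp [adj, triEdges_eq_image]

lemma edge_mem_triEdges (τ : M.Tri) (i : Fin 3) : edge τ i ∈ M.triEdges τ := by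
  classical
  simp [triEdges_eq_image]

lemma vert_mem_edge (τ : M.Tri) (hij : j ≠ i) : vert τ j ∈ edge τ i := by
  have hcases : ∀ i j : Fin 3, j ≠ i → j = i + 1 ∨ j = i + 2 := by decide
  rcases hcases i j hij with rfl | rfl <;> simp [edge]

/-- The signed distance of the vertex `i` of a triangle from the line of the opposite edge. -/
noncomputable def height (τ : M.Tri) (i : Fin 3) : ℝ :=
  M.normal (edge τ i) ⬝ᵥ (vert τ i - vert τ (i + 1)).ofLp

lemma sgn_eq_one_or_eq_neg_one (τ : M.Tri) (e : Sym2 Pt) : M.sgn τ e = 1 ∨ M.sgn τ e = -1 := by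
  unfold sgn
  split_ifs <;> simp

lemma sgn_mul_self (τ : M.Tri) (e : Sym2 Pt) : M.sgn τ e * M.sgn τ e = 1 := by
  rcases sgn_eq_one_or_eq_neg_one τ e with h | h <;> rw [h] <;> norm_num

/-- Twice the signed area of a triangle, with respect to the order of its vertices. -/
noncomputable def jac (τ : M.Tri) : ℝ :=
  det₂ (M.va τ - M.vc τ).ofLp (M.vb τ - M.vc τ).ofLp

lemma det₂_vert (τ : M.Tri) (i : Fin 3) :
    det₂ (vert τ (i + 2) - vert τ (i + 1)).ofLp (vert τ i - vert τ (i + 1)).ofLp = jac τ := by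
  fin_cases i <;> simp [vert, jac, det₂] <;> ring

namespace IsMeshOf

variable (hM : M.IsMeshOf Ω)
include hM

/-- The vertices of a triangle as an affine basis of the plane, whose coordinates are the
barycentric coordinates of the triangle. -/
noncomputable def basis (τ : M.Tri) : AffineBasis (Fin 3) ℝ Pt :=
  ⟨vert τ, hM.nondegenerate τ, by
    rw [vert, (hM.nondegenerate τ).affineSpan_eq_top_iff_card_eq_finrank_add_one]
    simp⟩

lemma basis_apply (τ : M.Tri) (i : Fin 3) : hM.basis τ i = vert τ i := rfl

lemma range_basis (τ : M.Tri) : Set.range (hM.basis τ) = M.triVerts τ := range_vert τ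

lemma mem_triSet : x ∈ M.triSet τ ↔ ∀ i, 0 ≤ (hM.basis τ).coord i x := by
  rw [triSet, ← hM.range_basis, AffineBasis.convexHull_eq_nonneg_coord, Set.mem_ofPred_eq]

lemma mem_interior_triSet : x ∈ interior (M.triSet τ) ↔ ∀ i, 0 < (hM.basis τ).coord i x := by
  rw [triSet, ← hM.range_basis, AffineBasis.interior_convexHull, Set.mem_ofPred_eq]

lemma centroid_mem_interior_triSet (τ : M.Tri) :
    Finset.univ.centroid ℝ (vert τ) ∈ interior (M.triSet τ) := by
  rw [triSet, ← hM.range_basis]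
  exact (hM.basis τ).centroid_mem_interior_convexHull

lemma coord_vert_ne (hij : j ≠ i) : (hM.basis τ).coord i (vert τ j) = 0 :=
  (hM.basis τ).coord_apply_ne hij.symm

lemma coord_vert_self : (hM.basis τ).coord i (vert τ i) = 1 := (hM.basis τ).coord_apply_eq i

lemma vert_injective (τ : M.Tri) : Function.Injective (vert τ) := (hM.basis τ).ind.injective

lemma vert_mem_edge_iff : vert τ j ∈ edge τ i ↔ j ≠ i := by
  refine ⟨?_, vert_mem_edge τ⟩
  rintro h rfl
  rcases Sym2.mem_iff.1 h with h | h
  · exact absurd (hM.vert_injective τ h) (by simp)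
  · exact absurd (hM.vert_injective τ h) (by simp)

lemma edge_injective (τ : M.Tri) : Function.Injective (edge τ) := fun i j h => by
  have hi : vert τ i ∉ edge τ j := h ▸ fun hi => hM.vert_mem_edge_iff.1 hi rfl
  rwa [hM.vert_mem_edge_iff, not_not] at hi

lemma sum_triEdges (τ : M.Tri) (f : Sym2 Pt → ℝ) :
    ∑ e ∈ M.triEdges τ, f e = ∑ i, f (edge τ i) := by
  classical
  rw [triEdges_eq_image, Finset.sum_image (hM.edge_injective τ).injOn]

lemma eq_of_triVerts_subset (h : M.triVerts τ ⊆ M.triVerts τ') : τ = τ' := by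
  have hcard : ∀ τ : M.Tri, (M.triVerts τ).ncard = 3 := fun τ => by
    rw [← range_vert, Set.ncard_range_of_injective (hM.vert_injective τ), Nat.card_fin]
  have hverts : M.triVerts τ = M.triVerts τ' :=
    Set.eq_of_subset_of_ncard_le h (by rw [hcard, hcard]) (range_vert τ' ▸ Set.finite_range _)
  have hset : M.triSet τ = M.triSet τ' := congrArg (convexHull ℝ) hverts
  by_contra hne
  have hcentroid := hM.centroid_mem_interior_triSet τ
  exact Set.disjoint_left.1 (hM.disjoint τ τ' hne) hcentroid (hset ▸ hcentroid)

lemma vert_mem_triVerts_of_coord_ne_zero (h : x ∈ M.triSet τ) (h' : x ∈ M.triSet τ')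
    (hi : (hM.basis τ).coord i x ≠ 0) : vert τ i ∈ M.triVerts τ' := by
  by_contra hnot
  refine hi (convexHull_min (t := (hM.basis τ).coord i ⁻¹' {0}) ?_ ?_ (hM.conforming τ τ' ⟨h, h'⟩))
  · rintro y ⟨hy, hy'⟩
    rw [← range_vert] at hy
    obtain ⟨j, rfl⟩ := hy
    exact hM.coord_vert_ne fun hji => hnot (hji ▸ hy')
  · exact (convex_singleton (0 : ℝ)).affine_preimage _

lemma eventually_lineMap_mem_interior {y : Pt}
    (h : ∀ i, 0 < (hM.basis τ).coord i x ∨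
      0 ≤ (hM.basis τ).coord i x ∧ 0 < (hM.basis τ).coord i y) :
    ∀ᶠ ε in 𝓝[>] (0 : ℝ), AffineMap.lineMap x y ε ∈ interior (M.triSet τ) := by
  simp only [hM.mem_interior_triSet]
  refine eventually_all.2 fun i => ?_
  rcases h i with hx | ⟨hx, hy⟩
  · have hcont := ((hM.basis τ).coord i).continuous_of_finiteDimensional
    exact eventually_lineMap_mem (hcont.continuousAt.preimage_mem_nhds (Ioi_mem_nhds hx)) y
  · filter_upwards [Ioc_mem_nhdsGT one_pos] with ε hε
    rw [AffineMap.apply_lineMap, AffineMap.lineMap_apply_module]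
    exact add_pos_of_nonneg_of_pos (smul_nonneg (sub_nonneg.2 hε.2) hx) (smul_pos hε.1 hy)

lemma normal_dot_sub_eq_zero {e : Sym2 Pt} (he : τ ∈ M.adj e) {y z : Pt} (hy : y ∈ e)
    (hz : z ∈ e) : M.normal e ⬝ᵥ (y - z).ofLp = 0 := by
  obtain ⟨i, rfl⟩ := mem_adj.1 he
  exact hM.normal_orth τ _ (edge_mem_triEdges τ i) y hy z hz

lemma normal_dot_self {e : Sym2 Pt} (he : τ ∈ M.adj e) : M.normal e ⬝ᵥ M.normal e = 1 := by
  obtain ⟨i, rfl⟩ := mem_adj.1 he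
  exact hM.normal_unit τ _ (edge_mem_triEdges τ i)

lemma normal_dot_sub (x : Pt) {y : Pt} (hy : y ∈ edge τ i) :
    M.normal (edge τ i) ⬝ᵥ (x - y).ofLp = (hM.basis τ).coord i x * height τ i := by
  have hcomb : x - y = ∑ j, (hM.basis τ).coord j x • (vert τ j - y) := by
    simp only [smul_sub, Finset.sum_sub_distrib, ← Finset.sum_smul,
      (hM.basis τ).sum_coord_apply_eq_one, one_smul, ← hM.basis_apply,
      (hM.basis τ).linear_combination_coord_eq_self]
  have hadj : τ ∈ M.adj (edge τ i) := mem_adj.2 ⟨i, rfl⟩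
  have hvert : M.normal (edge τ i) ⬝ᵥ (vert τ i - y).ofLp = height τ i := by
    have horth := hM.normal_dot_sub_eq_zero hadj (vert_mem_edge τ (j := i + 1) (by simp)) hy
    rw [height, ← sub_add_sub_cancel _ (vert τ (i + 1)), WithLp.ofLp_add, dotProduct_add, horth,
      add_zero]
  rw [hcomb, WithLp.ofLp_sum, dotProduct_sum, Finset.sum_eq_single i]
  · rw [WithLp.ofLp_smul, dotProduct_smul, hvert, smul_eq_mul]
  · intro j _ hji
    rw [WithLp.ofLp_smul, dotProduct_smul,
      hM.normal_dot_sub_eq_zero hadj (vert_mem_edge τ hji) hy, smul_zero]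
  · simp

lemma height_ne_zero (τ : M.Tri) (i : Fin 3) : height τ i ≠ 0 := by
  intro h
  have hsub := hM.normal_dot_sub (vert τ (i + 1) + WithLp.toLp 2 (M.normal (edge τ i)))
    (vert_mem_edge τ (i := i) (j := i + 1) (by simp))
  rw [h, mul_zero, add_sub_cancel_left, hM.normal_dot_self (mem_adj.2 ⟨i, rfl⟩)] at hsub
  exact one_ne_zero hsub

lemma isOutward_edge_iff : M.IsOutward τ (edge τ i) ↔ height τ i ≤ 0 := by
  refine ⟨fun h => h _ (vert_mem_triVerts τ i) _ (vert_mem_edge τ (by simp)),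
    fun h x hx y hy => ?_⟩
  rw [hM.normal_dot_sub x hy]
  exact mul_nonpos_of_nonneg_of_nonpos (hM.mem_triSet.1 (triVerts_subset_triSet τ hx) i) h

lemma sgn_mul_height (τ : M.Tri) (i : Fin 3) :
    M.sgn τ (edge τ i) * height τ i = -|height τ i| := by
  unfold sgn
  rw [hM.isOutward_edge_iff]
  split_ifs with h
  · rw [abs_of_nonpos h, one_mul, neg_neg]
  · rw [abs_of_pos (not_le.1 h), neg_one_mul]

lemma coord_midpoint {q r : Pt} (h : s(q, r) = edge τ i) (j : Fin 3) :
    (hM.basis τ).coord j (midpoint ℝ q r) = if j = i then 0 else 2⁻¹ := by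
  have hmid : midpoint ℝ q r = midpoint ℝ (vert τ (i + 1)) (vert τ (i + 2)) := by
    rcases Sym2.eq_iff.1 h with ⟨rfl, rfl⟩ | ⟨rfl, rfl⟩
    exacts [rfl, midpoint_comm _ _]
  have hcases : ∀ i j : Fin 3, j = i ∨ j = i + 1 ∨ j = i + 2 := by decide
  have hne : ∀ i : Fin 3, i + 1 ≠ i ∧ i + 2 ≠ i ∧ i + 1 ≠ i + 2 := by decide
  rw [hmid, AffineMap.map_midpoint, midpoint_eq_smul_add]
  rcases hcases i j with rfl | rfl | rfl <;>
    simp [hM.coord_vert_self, hM.coord_vert_ne, hne, (hne _).2.2.symm]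

lemma eventually_sub_mem_interior {q r : Pt} (h : τ ∈ M.adj s(q, r)) :
    ∀ᶠ ε in 𝓝[>] (0 : ℝ), AffineMap.lineMap (midpoint ℝ q r)
      (q - WithLp.toLp 2 (M.sgn τ s(q, r) • M.normal s(q, r))) ε ∈ interior (M.triSet τ) := by
  obtain ⟨i, hi⟩ := mem_adj.1 h
  refine hM.eventually_lineMap_mem_interior fun j => ?_
  rw [hM.coord_midpoint hi.symm]
  by_cases hji : j = i
  · subst hji
    refine .inr ⟨by simp, ?_⟩
    have hsub := hM.normal_dot_sub (q - WithLp.toLp 2 (M.sgn τ s(q, r) • M.normal s(q, r)))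
      (y := q) (hi ▸ Sym2.mem_mk_left q r)
    have hheight := hM.sgn_mul_height τ j
    rw [hi] at hsub hheight
    rw [sub_sub_cancel_left, WithLp.ofLp_neg, dotProduct_neg, dotProduct_smul,
      hM.normal_dot_self h, smul_eq_mul, mul_one] at hsub
    have hpos := abs_pos.2 (hM.height_ne_zero τ j)
    generalize (hM.basis τ).coord j _ = b at hsub ⊢
    have hprod : b * |height τ j| = 1 := by
      linear_combination M.sgn τ s(q, r) * hsub + sgn_mul_self τ s(q, r) + b * hheight
    exact pos_of_mul_pos_left (hprod ▸ one_pos) hpos.le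
  · exact .inl (by simp [hji])

lemma sgn_eq_neg (hne : τ ≠ τ') {e : Sym2 Pt} (he : τ ∈ M.adj e) (he' : τ' ∈ M.adj e) :
    M.sgn τ' e = -M.sgn τ e := by
  induction e using Sym2.ind with
  | _ q r =>
  by_contra hsgn
  have heq : M.sgn τ' s(q, r) = M.sgn τ s(q, r) := by
    rcases sgn_eq_one_or_eq_neg_one τ s(q, r) with h | h <;>
      rcases sgn_eq_one_or_eq_neg_one τ' s(q, r) with h' | h' <;> simp_all
  have hτ' := hM.eventually_sub_mem_interior he'
  rw [heq] at hτ'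
  obtain ⟨ε, hε, hε'⟩ := ((hM.eventually_sub_mem_interior he).and hτ').exists
  exact Set.disjoint_left.1 (hM.disjoint τ τ' hne) hε hε'

lemma card_adj_le_two (e : Sym2 Pt) : (M.adj e).card ≤ 2 := by
  by_contra! hcard
  obtain ⟨a, b, c, ha, hb, hc, hab, hac, hbc⟩ := Finset.two_lt_card_iff.1 hcard
  have hac' := hM.sgn_eq_neg hac ha hc
  rw [hM.sgn_eq_neg hbc hb hc, hM.sgn_eq_neg hab ha hb, neg_neg] at hac'
  rcases sgn_eq_one_or_eq_neg_one a e with h | h <;> rw [h] at hac' <;> norm_num at hac'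

lemma edgeLength_pos (τ : M.Tri) (i : Fin 3) : 0 < edgeLength (edge τ i) := by
  rw [edge, edgeLength_mk]
  exact dist_pos.2 ((hM.vert_injective τ).ne (by simp))

lemma edgeLength_mul_abs_height (τ : M.Tri) (i : Fin 3) :
    edgeLength (edge τ i) * |height τ i| = |jac τ| := by
  have hadj : τ ∈ M.adj (edge τ i) := mem_adj.2 ⟨i, rfl⟩
  have horth := hM.normal_dot_sub_eq_zero hadj (vert_mem_edge τ (j := i + 2) (by simp))
    (vert_mem_edge τ (j := i + 1) (by simp))
  have hlen : edgeLength (edge τ i) ^ 2 =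
      (vert τ (i + 2) - vert τ (i + 1)).ofLp ⬝ᵥ (vert τ (i + 2) - vert τ (i + 1)).ofLp := by
    rw [edge, edgeLength_mk, dist_comm, dist_eq_norm, dotProduct_ofLp_self]
  refine (sq_eq_sq₀ (mul_nonneg (hM.edgeLength_pos τ i).le (abs_nonneg _)) (abs_nonneg _)).1 ?_
  rw [mul_pow, sq_abs, sq_abs, hlen, ← det₂_vert τ i,
    sq_det₂_of_dotProduct_eq_zero (hM.normal_dot_self hadj) horth, height]

lemma abs_jac_pos (τ : M.Tri) : 0 < |jac τ| := by
  rw [← hM.edgeLength_mul_abs_height τ 0]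
  exact mul_pos (hM.edgeLength_pos τ 0) (abs_pos.2 (hM.height_ne_zero τ 0))

lemma sum_sgn_mul_normal_dot (τ : M.Tri) {y : Sym2 Pt → Pt} (hy : ∀ e, y e ∈ e) :
    ∑ e ∈ M.triEdges τ, M.sgn τ e * edgeLength e * (M.normal e ⬝ᵥ (y e).ofLp) = |jac τ| := by
  have hterm (i : Fin 3) : M.sgn τ (edge τ i) * edgeLength (edge τ i) *
      (M.normal (edge τ i) ⬝ᵥ (y (edge τ i)).ofLp) = (hM.basis τ).coord i 0 * |jac τ| := by
    have hsub := hM.normal_dot_sub 0 (hy (edge τ i))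
    rw [zero_sub, WithLp.ofLp_neg, dotProduct_neg] at hsub
    rw [← hM.edgeLength_mul_abs_height τ i]
    linear_combination -M.sgn τ (edge τ i) * edgeLength (edge τ i) * hsub -
      edgeLength (edge τ i) * (hM.basis τ).coord i 0 * hM.sgn_mul_height τ i
  rw [hM.sum_triEdges, Finset.sum_congr rfl fun i _ => hterm i, ← Finset.sum_mul,
    (hM.basis τ).sum_coord_apply_eq_one, one_mul]

end IsMeshOf

end MeshData

/-! ### Regular meshes -/

namespace MeshData

variable {M : MeshData} {Ω : Set Pt} {ρ c : ℝ} {τ τ' : M.Tri} {e : Sym2 Pt} {i : Fin 3} {x y : Pt}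

lemma triSet_subset_cellSet (τ : M.Tri) : M.triSet τ ⊆ M.cellSet τ.1 :=
  Set.subset_iUnion (fun i => M.triSet ⟨τ.1, i⟩) τ.2

lemma dist_vert_le_diam (τ : M.Tri) (i j : Fin 3) :
    dist (vert τ i) (vert τ j) ≤ Metric.diam (M.cellSet τ.1) := by
  have hmem (i : Fin 3) : vert τ i ∈ M.cellSet τ.1 :=
    triSet_subset_cellSet τ (triVerts_subset_triSet τ (vert_mem_triVerts τ i))
  have hbdd : Bornology.IsBounded (M.cellSet τ.1) :=
    (isCompact_iUnion fun _ => isCompact_triSet _).isBounded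
  exact Metric.dist_le_diam_of_mem hbdd (hmem i) (hmem j)

lemma mem_Fu : e ∈ M.Fu ↔ ∃ τ : M.Tri, edge τ 0 = e := by
  classical
  simp only [Fu, Finset.mem_image, Finset.mem_univ, true_and]
  rfl

lemma mem_Fp : e ∈ M.Fp ↔ ∃ τ : M.Tri, edge τ 2 = e := by
  classical
  simp only [Fp, Finset.mem_image, Finset.mem_univ, true_and]
  rfl

lemma edge_one_eq_edge_two (τ : M.Tri) : edge τ 1 = edge (M := M) ⟨τ.1, finRotate _ τ.2⟩ 2 :=
  edge_one τ

lemma edge_mem_Fp (τ : M.Tri) (hi : i ≠ 0) : edge τ i ∈ M.Fp := by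
  have hcases : ∀ i : Fin 3, i ≠ 0 → i = 1 ∨ i = 2 := by decide
  rcases hcases i hi with rfl | rfl
  exacts [mem_Fp.2 ⟨_, (edge_one_eq_edge_two τ).symm⟩, mem_Fp.2 ⟨τ, rfl⟩]

namespace IsMeshOf

variable (hM : M.IsMeshOf Ω)
include hM

lemma diam_pos (τ : M.Tri) : 0 < Metric.diam (M.cellSet τ.1) :=
  (dist_pos.2 ((hM.vert_injective τ).ne zero_ne_one)).trans_le (dist_vert_le_diam τ 0 1)

lemma card_adj_of_mem_Fp (he : e ∈ M.Fp) : (M.adj e).card = 2 := by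
  refine le_antisymm (hM.card_adj_le_two e) (Finset.one_lt_card.2 ?_)
  obtain ⟨τ, rfl⟩ := mem_Fp.1 he
  have hprev : edge (M := M) ⟨τ.1, (finRotate _).symm τ.2⟩ 1 = edge τ 2 := by
    rw [edge_one_eq_edge_two, Equiv.apply_symm_apply]
  refine ⟨τ, mem_adj.2 ⟨2, rfl⟩, _, mem_adj.2 ⟨1, hprev⟩, fun hτ => ?_⟩
  rw [← hτ] at hprev
  exact absurd (hM.edge_injective τ hprev) (by decide)

lemma sum_sgn_eq_zero (he : e ∈ M.Fp) : ∑ τ ∈ M.adj e, M.sgn τ e = 0 := by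
  classical
  obtain ⟨τ, τ', hne, hadj⟩ := Finset.card_eq_two.1 (hM.card_adj_of_mem_Fp he)
  rw [hadj, Finset.sum_pair hne,
    hM.sgn_eq_neg hne (hadj ▸ Finset.mem_insert_self _ _) (by simp [hadj]), add_neg_cancel]

lemma eq_of_mem_interior_triSet (h : x ∈ interior (M.triSet τ)) (h' : x ∈ M.triSet τ') :
    τ = τ' := by
  refine hM.eq_of_triVerts_subset ?_
  rw [← range_vert]
  rintro _ ⟨i, rfl⟩
  exact hM.vert_mem_triVerts_of_coord_ne_zero (interior_subset h) h'
    (hM.mem_interior_triSet.1 h i).ne'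

lemma coord_midpoint_side (τ : M.Tri) (j : Fin 3) :
    (hM.basis τ).coord j (midpoint ℝ (M.va τ) (M.vb τ)) = if j = 0 then 0 else 2⁻¹ :=
  hM.coord_midpoint (q := M.va τ) (r := M.vb τ) rfl j

lemma midpoint_side_mem_triSet_iff {τ' : M.Tri} (hcell : τ'.1 = τ.1) :
    midpoint ℝ (M.va τ) (M.vb τ) ∈ M.triSet τ' ↔ τ' = τ := by
  have hmem : midpoint ℝ (M.va τ) (M.vb τ) ∈ M.triSet τ :=
    hM.mem_triSet.2 fun j => by rw [hM.coord_midpoint_side]; split_ifs <;> norm_num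
  refine ⟨fun h => (hM.eq_of_triVerts_subset ?_).symm, fun h => h ▸ hmem⟩
  rw [← range_vert]
  rintro _ ⟨j, rfl⟩
  by_cases hj : j = 0
  · have hvc : vert τ 0 = vert τ' 0 := congrArg M.ν hcell.symm
    rw [hj, hvc]
    exact vert_mem_triVerts τ' 0
  · exact hM.vert_mem_triVerts_of_coord_ne_zero hmem h
      (by rw [hM.coord_midpoint_side, if_neg hj]; norm_num)

lemma eventually_mem_triSet_of_mem_cellSet (τ : M.Tri) :
    ∀ᶠ x in 𝓝 (midpoint ℝ (M.va τ) (M.vb τ)), x ∈ M.cellSet τ.1 → x ∈ M.triSet τ := by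
  have hother : ∀ᶠ x in 𝓝 (midpoint ℝ (M.va τ) (M.vb τ)),
      ∀ i, (⟨τ.1, i⟩ : M.Tri) ≠ τ → x ∉ M.triSet ⟨τ.1, i⟩ := by
    refine eventually_all.2 fun i => ?_
    by_cases hi : (⟨τ.1, i⟩ : M.Tri) = τ
    · exact .of_forall fun _ h => absurd hi h
    · have hmid := (hM.midpoint_side_mem_triSet_iff (τ := τ) (τ' := ⟨τ.1, i⟩) rfl).not.2 hi
      filter_upwards [(isCompact_triSet _).isClosed.isOpen_compl.mem_nhds hmid] with x hx _ using hx
  filter_upwards [hother] with x hx hcell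
  obtain ⟨i, hi⟩ := Set.mem_iUnion.1 hcell
  by_contra hτ
  exact hx i (fun h => hτ (h ▸ hi)) hi

lemma coord_zero_nonneg_of_starConvex (hy : StarConvex ℝ y (M.cellSet τ.1)) :
    0 ≤ (hM.basis τ).coord 0 y := by
  have hmid := (hM.midpoint_side_mem_triSet_iff (τ := τ) rfl).2 rfl
  have hseg : ∀ᶠ ε in 𝓝[>] (0 : ℝ),
      AffineMap.lineMap (midpoint ℝ (M.va τ) (M.vb τ)) y ε ∈ M.cellSet τ.1 := by
    filter_upwards [Ioc_mem_nhdsGT one_pos] with ε hε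
    refine hy.segment_subset (triSet_subset_cellSet τ hmid) ?_
    rw [segment_symm, segment_eq_image_lineMap]
    exact Set.mem_image_of_mem _ ⟨hε.1.le, hε.2⟩
  obtain ⟨ε, hcell, htri, hε⟩ := (hseg.and ((eventually_lineMap_mem
    (hM.eventually_mem_triSet_of_mem_cellSet τ) y).and self_mem_nhdsWithin)).exists
  have hcoord := hM.mem_triSet.1 (htri hcell) 0
  rw [AffineMap.apply_lineMap, hM.coord_midpoint_side, if_pos rfl,
    AffineMap.lineMap_apply_module, smul_zero, zero_add] at hcoord
  exact nonneg_of_mul_nonneg_right hcoord hε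

variable (hR : M.IsRegular ρ c)
include hR

lemma mul_diam_le_abs_height_zero (τ : M.Tri) :
    ρ * Metric.diam (M.cellSet τ.1) ≤ |height τ 0| := by
  by_contra! hlt
  obtain ⟨s, hs, hs'⟩ := exists_between hlt
  have hadj : τ ∈ M.adj (edge τ 0) := mem_adj.2 ⟨0, rfl⟩
  have hunit := hM.normal_dot_self hadj
  have hsgn := sgn_mul_self τ (edge τ 0)
  -- The point at distance `s` from `ν` towards the side lies beyond the line of the side.
  obtain ⟨w, hw⟩ : ∃ w : Pt, w.ofLp = (s * M.sgn τ (edge τ 0)) • M.normal (edge τ 0) := ⟨_, rfl⟩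
  have hnorm : ‖w‖ ^ 2 = s ^ 2 := by
    rw [← dotProduct_ofLp_self, hw, dotProduct_smul, smul_dotProduct, hunit, smul_eq_mul,
      smul_eq_mul]
    linear_combination s ^ 2 * hsgn
  have hball : M.vc τ + w ∈ Metric.ball (M.vc τ) (ρ * Metric.diam (M.cellSet τ.1)) := by
    rw [mem_ball_iff_norm, add_sub_cancel_left]
    exact (abs_le_of_sq_le_sq' hnorm.le ((abs_nonneg _).trans hs.le)).2.trans_lt hs'
  have hcoord := hM.coord_zero_nonneg_of_starConvex (hR.star τ.1 _ hball)
  have hdot := hM.normal_dot_sub (M.vc τ + w) (τ := τ) (i := 0) (Sym2.mem_mk_left (M.va τ) _)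
  have hheight : M.normal (edge τ 0) ⬝ᵥ (M.vc τ - M.va τ).ofLp = height τ 0 := rfl
  rw [add_sub_right_comm, WithLp.ofLp_add, dotProduct_add, hheight, hw, dotProduct_smul, hunit,
    smul_eq_mul, mul_one] at hdot
  have heq : (hM.basis τ).coord 0 (M.vc τ + w) * |height τ 0| = |height τ 0| - s := by
    linear_combination M.sgn τ (edge τ 0) * hdot - s * hsgn +
      ((hM.basis τ).coord 0 (M.vc τ + w) - 1) * hM.sgn_mul_height τ 0
  exact (mul_nonneg hcoord (abs_nonneg (height τ 0))).not_gt (heq ▸ sub_neg.2 hs)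

lemma mul_diam_le_abs_height (hρ : 0 < ρ) (τ : M.Tri) (i : Fin 3) :
    ρ * c * Metric.diam (M.cellSet τ.1) ≤ |height τ i| := by
  have hdiam := hM.diam_pos τ
  have hside : c * Metric.diam (M.cellSet τ.1) ≤ edgeLength (edge τ 0) := hR.side τ
  refine le_of_mul_le_mul_left ?_ hdiam
  calc Metric.diam (M.cellSet τ.1) * (ρ * c * Metric.diam (M.cellSet τ.1))
      = (c * Metric.diam (M.cellSet τ.1)) * (ρ * Metric.diam (M.cellSet τ.1)) := by ring
    _ ≤ edgeLength (edge τ 0) * |height τ 0| :=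
        mul_le_mul hside (hM.mul_diam_le_abs_height_zero hR τ) (by positivity)
          (hM.edgeLength_pos τ 0).le
    _ = edgeLength (edge τ i) * |height τ i| := by
        rw [hM.edgeLength_mul_abs_height, hM.edgeLength_mul_abs_height]
    _ ≤ Metric.diam (M.cellSet τ.1) * |height τ i| :=
        mul_le_mul_of_nonneg_right (dist_vert_le_diam τ _ _) (abs_nonneg _)

lemma shapeRegular (hρ : 0 < ρ) (hc : 0 < c) (τ : M.Tri) :
    ShapeRegular (M.normal (edge τ 0)) (M.normal (edge τ 2)) (M.normal (edge τ 1))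
      (M.va τ - M.vc τ).ofLp (M.vb τ - M.vc τ).ofLp (Metric.diam (M.cellSet τ.1)) (ρ * c) := by
  have hside : (M.vb τ - M.vc τ).ofLp - (M.va τ - M.vc τ).ofLp = (M.vb τ - M.va τ).ofLp := by
    rw [← WithLp.ofLp_sub, sub_sub_sub_cancel_right]
  have hunit (i : Fin 3) := hM.normal_dot_self (mem_adj.2 ⟨i, rfl⟩ : τ ∈ M.adj (edge τ i))
  have horth {i j k : Fin 3} (hj : j ≠ i) (hk : k ≠ i) :=
    hM.normal_dot_sub_eq_zero (mem_adj.2 ⟨i, rfl⟩) (vert_mem_edge τ hj) (vert_mem_edge τ hk)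
  have hlen (i j : Fin 3) : (vert τ i - vert τ j).ofLp ⬝ᵥ (vert τ i - vert τ j).ofLp ≤
      Metric.diam (M.cellSet τ.1) ^ 2 := by
    rw [dotProduct_ofLp_self, ← dist_eq_norm]
    exact pow_le_pow_left₀ dist_nonneg (dist_vert_le_diam τ i j) 2
  have hheight₁ : M.normal (edge τ 1) ⬝ᵥ (M.va τ - M.vc τ).ofLp = height τ 1 := by
    have hdot := hM.normal_dot_sub (M.va τ) (vert_mem_edge τ (i := 1) zero_ne_one)
    rwa [show M.va τ = vert τ 1 from rfl, hM.coord_vert_self, one_mul] at hdot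
  exact
    { h_pos := hM.diam_pos τ
      κ_pos := mul_pos hρ hc
      unit₀ := hunit 0
      unit₁ := hunit 2
      unit₂ := hunit 1
      orth₀ := hside ▸ horth (i := 0) (j := 2) (k := 1) (by decide) (by decide)
      orth₁ := horth (i := 2) (j := 1) (k := 0) (by decide) (by decide)
      orth₂ := horth (i := 1) (j := 2) (k := 0) (by decide) (by decide)
      len₀ := hside ▸ hlen 2 1
      len₁ := hlen 1 0
      len₂ := hlen 2 0
      height₁ := hM.mul_diam_le_abs_height hR hρ τ 2
      height₂ := hheight₁ ▸ hM.mul_diam_le_abs_height hR hρ τ 1 }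

variable (hρ : 0 < ρ)
include hρ

lemma cell_eq_of_vc_mem_triVerts (h : M.vc τ ∈ M.triVerts τ') : τ'.1 = τ.1 := by
  have hball : Metric.ball (M.vc τ) (ρ * Metric.diam (M.cellSet τ.1)) ⊆ M.cellSet τ.1 :=
    fun y hy => (hR.star _ y hy).mem
      ⟨M.vc τ, triSet_subset_cellSet τ (triVerts_subset_triSet τ (vert_mem_triVerts τ 0))⟩
  have hnhds : M.cellSet τ.1 ∈ 𝓝 (M.vc τ) :=
    mem_of_superset (Metric.ball_mem_nhds _ (mul_pos hρ (hM.diam_pos τ))) hball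
  have hint := hM.eventually_lineMap_mem_interior (τ := τ') (x := M.vc τ) fun i =>
    .inr ⟨hM.mem_triSet.1 (triVerts_subset_triSet τ' h) i,
      hM.mem_interior_triSet.1 (hM.centroid_mem_interior_triSet τ') i⟩
  obtain ⟨ε, hτ', hτ⟩ := (hint.and (eventually_lineMap_mem hnhds _)).exists
  obtain ⟨j, hj⟩ := Set.mem_iUnion.1 hτ
  rw [hM.eq_of_mem_interior_triSet hτ' hj]

lemma edge_mem_Fu_iff : edge τ i ∈ M.Fu ↔ i = 0 := by
  refine ⟨fun h => ?_, fun h => h ▸ mem_Fu.2 ⟨τ, rfl⟩⟩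
  by_contra hi
  obtain ⟨τ', hτ'⟩ := mem_Fu.1 h
  have hvc : M.vc τ ∈ edge τ' 0 := hτ' ▸ vert_mem_edge τ (Ne.symm hi)
  have hverts : M.vc τ ∈ M.triVerts τ' := by
    rcases Sym2.mem_iff.1 hvc with h | h <;> rw [h]
    exacts [vert_mem_triVerts τ' 1, vert_mem_triVerts τ' 2]
  have hcell : M.vc τ = vert τ' 0 := congrArg M.ν (hM.cell_eq_of_vc_mem_triVerts hR hρ hverts).symm
  exact hM.vert_mem_edge_iff.1 (hcell ▸ hvc) rfl

lemma edge_mem_Fp_iff : edge τ i ∈ M.Fp ↔ i ≠ 0 := by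
  refine ⟨?_, edge_mem_Fp τ⟩
  rintro h rfl
  obtain ⟨τ', hτ'⟩ := mem_Fp.1 h
  have h' : edge τ' 2 ∈ M.Fu := mem_Fu.2 ⟨τ, hτ'.symm⟩
  exact absurd ((hM.edge_mem_Fu_iff hR hρ).1 h') (by decide)

end IsMeshOf

end MeshData

/-! ### Norms and traces -/

@[fun_prop]
lemma continuous_frob_mval (p q : Matrix (Fin 2) (Fin 2) (MvPolynomial (Fin 2) ℝ)) :
    Continuous fun x => frob (mval p x) (mval q x) := by
  simp only [frob, mval, Matrix.of_apply]
  fun_prop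

namespace MeshData

variable {M : MeshData} {Ω : Set Pt} {τ : M.Tri} {e : Sym2 Pt} {v : M.VField} {k : ℕ}

lemma integrableOn_triSet {f : Pt → ℝ} (hf : Continuous f) (τ : M.Tri) :
    IntegrableOn f (M.triSet τ) :=
  hf.continuousOn.integrableOn_compact (isCompact_triSet τ)

/-- The squared `L²` norm of a piecewise polynomial matrix field. -/
noncomputable def l2Sq (Q : M.MField) : ℝ :=
  ∑ τ, ∫ x in M.triSet τ, frob (mval (Q τ) x) (mval (Q τ) x)

/-- The elementwise gradient `∇_h v`. -/
noncomputable def gradField (v : M.VField) : M.MField := fun τ => grad (v τ)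

/-- The contribution of an edge to the squared norm `‖v‖_{Z₂}²`. -/
noncomputable def jumpTerm (v : M.VField) (e : Sym2 Pt) : ℝ :=
  (edgeLength e)⁻¹ * edgeIntegral (fun x => M.jump v e x ⬝ᵥ M.jump v e x) e

/-- The contribution of the edges to the squared norm `‖v‖_{Z₂}²`. -/
noncomputable def jumpPart (v : M.VField) : ℝ :=
  ∑ e ∈ M.Fu, jumpTerm v e + ∑ e ∈ M.Fp, jumpTerm v e

lemma integral_frob_self_nonneg (Q : M.MField) (τ : M.Tri) :
    0 ≤ ∫ x in M.triSet τ, frob (mval (Q τ) x) (mval (Q τ) x) :=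
  integral_nonneg fun _ => frob_self_nonneg _

lemma l2Sq_nonneg (Q : M.MField) : 0 ≤ l2Sq Q :=
  Finset.sum_nonneg fun τ _ => integral_frob_self_nonneg Q τ

lemma jumpTerm_nonneg (v : M.VField) (e : Sym2 Pt) : 0 ≤ jumpTerm v e :=
  mul_nonneg (inv_nonneg.2 (edgeLength_nonneg e))
    (edgeIntegral_nonneg e fun _ => dotProduct_self_nonneg _)

lemma jumpPart_nonneg (v : M.VField) : 0 ≤ jumpPart v :=
  add_nonneg (Finset.sum_nonneg fun e _ => jumpTerm_nonneg v e)
    (Finset.sum_nonneg fun e _ => jumpTerm_nonneg v e)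

lemma tangent_eq_perp (e : Sym2 Pt) : M.tangent e = perp (M.normal e) := rfl

lemma jump_dotProduct (v : M.VField) (e : Sym2 Pt) (x : Pt) (w : Fin 2 → ℝ) :
    M.jump v e x ⬝ᵥ w = ∑ τ ∈ M.adj e, M.sgn τ e * (vval (v τ) x ⬝ᵥ w) := by
  simp only [jump, sum_dotProduct, smul_dotProduct, smul_eq_mul]

lemma jumpTan_eq (v : M.VField) (e : Sym2 Pt) (x : Pt) :
    M.jumpTan v e x = (M.jump v e x ⬝ᵥ M.tangent e) • M.tangent e := by
  rw [jump_dotProduct, jumpTan, Finset.sum_smul]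
  exact Finset.sum_congr rfl fun τ _ => smul_smul _ _ _

lemma eq_tangent_of_dot_normal_eq_zero (hn : M.normal e ⬝ᵥ M.normal e = 1) {a : Fin 2 → ℝ}
    (ha : a ⬝ᵥ M.normal e = 0) : a = (a ⬝ᵥ M.tangent e) • M.tangent e := by
  simp only [tangent_eq_perp, perp, dotProduct, Fin.sum_univ_two, Matrix.cons_val_zero,
    Matrix.cons_val_one] at hn ha ⊢
  ext i
  fin_cases i
  · change a 0 = (a 0 * -M.normal e 1 + a 1 * M.normal e 0) * -M.normal e 1
    linear_combination -a 0 * hn + M.normal e 0 * ha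
  · change a 1 = (a 0 * -M.normal e 1 + a 1 * M.normal e 0) * M.normal e 0
    linear_combination -a 1 * hn + M.normal e 1 * ha

lemma sum_triEdges_comm (f : M.Tri → Sym2 Pt → ℝ) [DecidableEq (Sym2 Pt)] :
    ∑ τ, ∑ e ∈ M.triEdges τ, f τ e = ∑ e ∈ M.Fu ∪ M.Fp, ∑ τ ∈ M.adj e, f τ e := by
  refine Finset.sum_comm' fun τ e => ?_
  have hmem : e ∈ M.triEdges τ → e ∈ M.Fu ∪ M.Fp := fun h => by
    rw [triEdges_eq_image, Finset.mem_image] at h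
    obtain ⟨i, -, rfl⟩ := h
    obtain rfl | hi := eq_or_ne i 0
    · exact Finset.mem_union_left _ (mem_Fu.2 ⟨τ, rfl⟩)
    · exact Finset.mem_union_right _ (edge_mem_Fp τ hi)
  simp only [adj, Finset.mem_univ, Finset.mem_filter, true_and]
  exact ⟨fun h => ⟨h, hmem h⟩, And.left⟩

namespace IsMeshOf

variable (hM : M.IsMeshOf Ω)
include hM

lemma integral_triSet (τ : M.Tri) (i : Fin 3) (f : Pt → ℝ) :
    ∫ x in M.triSet τ, f x = |jac τ| *
      ∫ x in refTri, f (refMap (vert τ i) (vert τ (i + 1)) (vert τ (i + 2)) x) := by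
  have hset : M.triSet τ = convexHull ℝ {vert τ i, vert τ (i + 1), vert τ (i + 2)} := by
    rw [triSet, ← range_vert]
    congr 1
    ext x
    simp only [Set.mem_range, Fin.exists_fin_succ, IsEmpty.exists_iff, or_false,
      Set.mem_insert_iff, Set.mem_singleton_iff, eq_comm (b := x)]
    fin_cases i <;> simp <;> tauto
  have hdet : det₂ (vert τ (i + 1) - vert τ i).ofLp (vert τ (i + 2) - vert τ i).ofLp = jac τ := by
    fin_cases i <;> simp [vert, jac, det₂] <;> ring
  rw [hset, ← hdet]
  exact integral_convexHull (hdet ▸ abs_pos.1 (hM.abs_jac_pos τ)) f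

lemma eq_zero_of_integral_triSet_sq_eq_zero {p : MvPolynomial (Fin 2) ℝ}
    (h : ∫ x in M.triSet τ, pval p x ^ 2 = 0) : p = 0 :=
  eq_zero_of_setIntegral_mul_sq_eq_zero (isCompact_triSet τ) (w := fun _ => 1) continuous_const
    (fun _ _ => zero_le_one) isOpen_interior ⟨_, hM.centroid_mem_interior_triSet τ⟩
    interior_subset (fun _ _ => one_pos) (by simpa only [one_mul] using h)

lemma eq_zero_of_l2Sq_nonpos {Q : M.MField} (h : l2Sq Q ≤ 0) : Q = 0 := by
  have hzero := (Finset.sum_eq_zero_iff_of_nonneg fun τ _ => integral_frob_self_nonneg Q τ).1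
    (h.antisymm (l2Sq_nonneg Q))
  ext1 τ
  ext1 i j
  refine hM.eq_zero_of_integral_triSet_sq_eq_zero (τ := τ) (le_antisymm ?_ (by positivity))
  rw [← hzero τ (Finset.mem_univ τ)]
  exact setIntegral_mono (integrableOn_triSet (by fun_prop) τ)
    (integrableOn_triSet (by fun_prop) τ) fun x => sq_apply_le_frob_self (mval (Q τ) x) i j

lemma jump_dot_normal_eq_zero (hv : v ∈ M.U k) (he : e ∈ M.Fp) {x : Pt} (hx : x ∈ edgeSet e) :
    M.jump v e x ⬝ᵥ M.normal e = 0 := by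
  obtain ⟨τ, hτ⟩ := mem_Fp.1 he
  have hadj : τ ∈ M.adj e := mem_adj.2 ⟨2, hτ⟩
  rw [jump_dotProduct, Finset.sum_congr rfl fun σ hσ => by
    rw [hv.2 e he σ hσ τ hadj x hx], ← Finset.sum_mul, hM.sum_sgn_eq_zero he, zero_mul]

lemma jumpTan_eq_jump (hv : v ∈ M.U k) (he : e ∈ M.Fp) {x : Pt} (hx : x ∈ edgeSet e) :
    M.jumpTan v e x = M.jump v e x := by
  obtain ⟨τ, hτ⟩ := mem_Fp.1 he
  rw [jumpTan_eq, ← eq_tangent_of_dot_normal_eq_zero (hM.normal_dot_self (mem_adj.2 ⟨2, hτ⟩))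
    (hM.jump_dot_normal_eq_zero hv he hx)]

lemma normZ2_eq (hv : v ∈ M.U k) : M.normZ2 v = √(l2Sq (gradField v) + jumpPart v) := by
  have hFp : ∑ e ∈ M.Fp, (edgeLength e)⁻¹ *
      edgeIntegral (fun x => M.jumpTan v e x ⬝ᵥ M.jumpTan v e x) e =
      ∑ e ∈ M.Fp, jumpTerm v e := Finset.sum_congr rfl fun e he => by
    rw [jumpTerm, edgeIntegral_congr fun x hx => by rw [hM.jumpTan_eq_jump hv he hx]]
  rw [normZ2, hFp, add_assoc]
  rfl

lemma sum_jumpTerm_edge_le (v : M.VField) :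
    ∑ τ : M.Tri, ∑ i, jumpTerm v (edge τ i) ≤ 2 * jumpPart v := by
  classical
  calc ∑ τ : M.Tri, ∑ i, jumpTerm v (edge τ i)
      = ∑ e ∈ M.Fu ∪ M.Fp, (M.adj e).card * jumpTerm v e := by
        simp only [← hM.sum_triEdges, sum_triEdges_comm, Finset.sum_const, nsmul_eq_mul]
    _ ≤ ∑ e ∈ M.Fu ∪ M.Fp, 2 * jumpTerm v e := Finset.sum_le_sum fun e _ =>
        mul_le_mul_of_nonneg_right (mod_cast hM.card_adj_le_two e) (jumpTerm_nonneg v e)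
    _ ≤ 2 * jumpPart v := by
        rw [← Finset.mul_sum, jumpPart, ← Finset.sum_union_inter]
        gcongr
        exact le_add_of_nonneg_right (Finset.sum_nonneg fun e _ => jumpTerm_nonneg v e)

lemma sum_sgn_mul_sq_eq_zero {u : M.Tri → ℝ} (h : ∑ τ ∈ M.adj e, M.sgn τ e * u τ = 0) :
    ∑ τ ∈ M.adj e, M.sgn τ e * u τ ^ 2 = 0 := by
  have hsgn (τ : M.Tri) : M.sgn τ e ≠ 0 := left_ne_zero_of_mul_eq_one (sgn_mul_self τ e)
  have hcard := hM.card_adj_le_two e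
  interval_cases hn : (M.adj e).card
  · rw [Finset.card_eq_zero.1 hn, Finset.sum_empty]
  · obtain ⟨τ, hτ⟩ := Finset.card_eq_one.1 hn
    rw [hτ, Finset.sum_singleton] at h ⊢
    rw [(mul_eq_zero.1 h).resolve_left (hsgn τ), zero_pow two_ne_zero, mul_zero]
  · obtain ⟨τ, τ', hne, hτ⟩ := Finset.card_eq_two.1 hn
    have hneg := hM.sgn_eq_neg hne (e := e) (by simp [hτ]) (by simp [hτ])
    rw [hτ, Finset.sum_pair hne, hneg] at h ⊢
    have heq : u τ = u τ' := mul_left_cancel₀ (hsgn τ) (by linarith)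
    rw [heq]
    ring

/- The discrete divergence theorem for the piecewise constant field `u² (x ↦ x)`: its normal flux
through the edges cancels, and its divergence integrates to a positive multiple of `u²` on each
triangle. -/
lemma eq_zero_of_sum_sgn_mul_eq_zero {u : M.Tri → ℝ}
    (hu : ∀ (τ : M.Tri) i, ∑ σ ∈ M.adj (edge τ i), M.sgn σ (edge τ i) * u σ = 0) : u = 0 := by
  classical
  have hflux (e : Sym2 Pt) : ∑ τ ∈ M.adj e,
      u τ ^ 2 * (M.sgn τ e * edgeLength e * (M.normal e ⬝ᵥ e.out.1.ofLp)) = 0 := by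
    have hsq : ∑ τ ∈ M.adj e, M.sgn τ e * u τ ^ 2 = 0 := by
      obtain hempty | ⟨τ, hτ⟩ := (M.adj e).eq_empty_or_nonempty
      · rw [hempty, Finset.sum_empty]
      · obtain ⟨i, rfl⟩ := mem_adj.1 hτ
        exact hM.sum_sgn_mul_sq_eq_zero (hu τ i)
    calc _ = (∑ τ ∈ M.adj e, M.sgn τ e * u τ ^ 2) *
          (edgeLength e * (M.normal e ⬝ᵥ e.out.1.ofLp)) := by
          rw [Finset.sum_mul]
          exact Finset.sum_congr rfl fun τ _ => by ring
      _ = 0 := by rw [hsq, zero_mul]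
  have hsum : ∑ τ : M.Tri, u τ ^ 2 * |jac τ| = 0 := by
    simp only [← hM.sum_sgn_mul_normal_dot _ Sym2.out_fst_mem, Finset.mul_sum, sum_triEdges_comm,
      hflux, Finset.sum_const_zero]
  ext τ
  have hzero := (Finset.sum_eq_zero_iff_of_nonneg fun τ _ => by positivity).1 hsum τ
    (Finset.mem_univ τ)
  exact pow_eq_zero_iff two_ne_zero |>.1 <|
    (mul_eq_zero.1 hzero).resolve_right (hM.abs_jac_pos τ).ne'

lemma eq_zero_of_gradField_eq_zero (hgrad : gradField v = 0) (hjump : jumpPart v ≤ 0) : v = 0 := by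
  have hconst (τ : M.Tri) (i : Fin 2) : v τ i = C (coeff 0 (v τ i)) :=
    eq_C_of_pderiv_eq_zero fun j => congrFun (congrFun (congrFun hgrad τ) i) j
  have hterm (τ : M.Tri) (i : Fin 3) : jumpTerm v (edge τ i) = 0 := by
    have hnonneg (τ : M.Tri) : 0 ≤ ∑ i, jumpTerm v (edge τ i) :=
      Finset.sum_nonneg fun i _ => jumpTerm_nonneg v _
    have hsum : ∑ τ : M.Tri, ∑ i, jumpTerm v (edge τ i) = 0 :=
      ((hM.sum_jumpTerm_edge_le v).trans (by linarith)).antisymm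
        (Finset.sum_nonneg fun τ _ => hnonneg τ)
    have hτ := (Finset.sum_eq_zero_iff_of_nonneg fun τ _ => hnonneg τ).1 hsum τ (Finset.mem_univ τ)
    exact (Finset.sum_eq_zero_iff_of_nonneg fun i _ => jumpTerm_nonneg v _).1 hτ i
      (Finset.mem_univ i)
  have hjump_zero (τ : M.Tri) (i : Fin 3) :
      ∑ σ ∈ M.adj (edge τ i), M.sgn σ (edge τ i) • (fun l => coeff 0 (v σ l)) = 0 := by
    have hvval (σ : M.Tri) (x : Pt) : vval (v σ) x = fun l => coeff 0 (v σ l) := funext fun l => by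
      rw [vval, hconst, pval_C, coeff_C, if_pos rfl]
    have h := hterm τ i
    simp only [jumpTerm, jump, hvval, edgeIntegral_const,
      inv_mul_cancel_left₀ (hM.edgeLength_pos τ i).ne'] at h
    exact dotProduct_self_eq_zero.1 h
  have hcoeff (l : Fin 2) : (fun τ => coeff 0 (v τ l)) = 0 :=
    hM.eq_zero_of_sum_sgn_mul_eq_zero fun τ i => by simpa using congrFun (hjump_zero τ i) l
  ext1 τ
  ext1 l
  rw [hconst, congrFun (hcoeff l) τ]
  exact C_0

lemma normZ2_pos (hv : v ∈ M.U k) (h0 : v ≠ 0) : 0 < M.normZ2 v := by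
  rw [hM.normZ2_eq hv, Real.sqrt_pos]
  by_contra! hle
  have hgrad : gradField v = 0 := hM.eq_zero_of_l2Sq_nonpos (by linarith [jumpPart_nonneg v])
  exact h0 (hM.eq_zero_of_gradField_eq_zero hgrad (by linarith [l2Sq_nonneg (gradField v)]))

lemma normX'_pos {G : M.MField} (h0 : G ≠ 0) : 0 < M.normX' G := by
  have hG : 0 < l2Sq G := by
    by_contra! hle
    exact h0 (hM.eq_zero_of_l2Sq_nonpos hle)
  have hFu : 0 ≤ ∑ e ∈ M.Fu, edgeLength e *
      edgeIntegral (fun x => M.normalTrace G e x ⬝ᵥ M.normalTrace G e x) e :=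
    Finset.sum_nonneg fun e _ => mul_nonneg (edgeLength_nonneg e)
      (edgeIntegral_nonneg e fun _ => dotProduct_self_nonneg _)
  have hFp : 0 ≤ ∑ e ∈ M.Fp, edgeLength e *
      edgeIntegral (fun x => (M.normalTrace G e x ⬝ᵥ M.tangent e) ^ 2) e :=
    Finset.sum_nonneg fun e _ => mul_nonneg (edgeLength_nonneg e)
      (edgeIntegral_nonneg e fun _ => sq_nonneg _)
  exact Real.sqrt_pos.2 (add_pos_of_pos_of_nonneg (add_pos_of_pos_of_nonneg hG hFu) hFp)

end IsMeshOf

end MeshData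

/-! ### Barycentric coordinates and edge projections -/

/-- The contraction `X : ∇p` of the gradient of a polynomial vector field with a constant matrix. -/
noncomputable def contract (X : Matrix (Fin 2) (Fin 2) ℝ) (p : Fin 2 → MvPolynomial (Fin 2) ℝ) :
    MvPolynomial (Fin 2) ℝ :=
  ∑ i, ∑ j, C (X i j) * pderiv j (p i)

section Contraction

variable {k : ℕ} {p : Fin 2 → MvPolynomial (Fin 2) ℝ} (X : Matrix (Fin 2) (Fin 2) ℝ)

lemma pval_contract (p : Fin 2 → MvPolynomial (Fin 2) ℝ) (x : Pt) :
    pval (contract X p) x = frob X (mval (grad p) x) := by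
  simp only [contract, pval_sum, pval_mul, pval_C]
  rfl

lemma mul_contract_mem_P {l : MvPolynomial (Fin 2) ℝ} (hl : l ∈ P 1) (hp : ∀ i, p i ∈ P k) :
    l * contract X p ∈ P k := by
  simp only [contract, Finset.mul_sum, mul_left_comm l]
  exact (P k).sum_mem fun i _ => (P k).sum_mem fun j _ =>
    C_mul_mem_P (mul_pderiv_mem_P hl (hp i) j) _

lemma contract_mem_P (hp : ∀ i, p i ∈ P k) : contract X p ∈ P k := by
  simpa only [one_mul] using mul_contract_mem_P X (l := 1) (mem_P.2 (by simp)) hp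

end Contraction

namespace MeshData

variable {M : MeshData} {Ω : Set Pt} {τ : M.Tri} {e : Sym2 Pt} {v : M.VField} {k : ℕ}
  {ρ c θ : ℝ} {i : Fin 3} {m : Fin 4} {x : Pt}

lemma abs_height_le_edgeLength {τ : M.Tri} (i : Fin 3)
    (hn : M.normal (edge τ i) ⬝ᵥ M.normal (edge τ i) = 1) :
    |height τ i| ≤ edgeLength (edge τ (i + 2)) := by
  have hedge : edge τ (i + 2) = s(vert τ i, vert τ (i + 1)) := by
    fin_cases i <;> rfl
  rw [hedge, edgeLength_mk, dist_eq_norm, ← abs_of_nonneg (norm_nonneg (vert τ i - _)), ← sq_le_sq,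
    ← dotProduct_ofLp_self]
  exact (dotProduct_sq_le _ _).trans_eq (by rw [hn, one_mul])

lemma exists_eq_lineMap_of_mem_edgeSet (hx : x ∈ edgeSet (edge τ i)) :
    ∃ s, x = AffineMap.lineMap (vert τ (i + 1)) (vert τ (i + 2)) (s : ℝ) := by
  rw [edge, edgeSet_mk, segment_eq_image_lineMap] at hx
  obtain ⟨s, -, rfl⟩ := hx
  exact ⟨s, rfl⟩

namespace IsMeshOf

variable (hM : M.IsMeshOf Ω)
include hM

lemma abs_jac_le (hR : M.IsRegular ρ c) (hρ : 0 < ρ) (hc : 0 < c) (τ : M.Tri) (i : Fin 3) :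
    |jac τ| ≤ (ρ * c)⁻¹ * edgeLength (edge τ i) ^ 2 := by
  have hheight : |height τ (i + 1)| ≤ edgeLength (edge τ i) := by
    have h := abs_height_le_edgeLength (τ := τ) (i + 1) (hM.normal_dot_self (mem_adj.2 ⟨_, rfl⟩))
    have hi : i + 1 + 2 = i := by
      fin_cases i <;> rfl
    rwa [hi] at h
  have hdiam := hM.mul_diam_le_abs_height hR hρ τ (i + 1)
  have hlen : |height τ i| ≤ Metric.diam (M.cellSet τ.1) := by
    refine (abs_height_le_edgeLength i (hM.normal_dot_self (mem_adj.2 ⟨_, rfl⟩))).trans ?_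
    exact dist_vert_le_diam τ _ _
  have hl := hM.edgeLength_pos τ i
  rw [← hM.edgeLength_mul_abs_height τ i, inv_mul_eq_div, le_div_iff₀ (mul_pos hρ hc)]
  calc edgeLength (edge τ i) * |height τ i| * (ρ * c)
      ≤ edgeLength (edge τ i) * Metric.diam (M.cellSet τ.1) * (ρ * c) := by gcongr
    _ ≤ edgeLength (edge τ i) ^ 2 := by nlinarith

/-- The affine map of the plane onto the line of the edge `i` of a triangle that fixes this line and
maps the opposite vertex to the vertex `i + 1`. It extends polynomials from the edge to the
triangle. -/
noncomputable def edgeProj (τ : M.Tri) (i : Fin 3) : Pt →ᵃ[ℝ] Pt :=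
  (AffineMap.lineMap (vert τ (i + 1)) (vert τ (i + 2))).comp ((hM.basis τ).coord (i + 2))

lemma edgeProj_apply (τ : M.Tri) (i : Fin 3) (x : Pt) : hM.edgeProj τ i x =
    AffineMap.lineMap (vert τ (i + 1)) (vert τ (i + 2)) ((hM.basis τ).coord (i + 2) x) := rfl

lemma edgeProj_eq_self (hx : x ∈ edgeSet (edge τ i)) : hM.edgeProj τ i x = x := by
  obtain ⟨s, rfl⟩ := exists_eq_lineMap_of_mem_edgeSet hx
  rw [edgeProj_apply, AffineMap.apply_lineMap, hM.coord_vert_self, hM.coord_vert_ne (by simp),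
    AffineMap.lineMap_apply_ring', sub_zero, mul_one, add_zero]

lemma coord_eq_zero_of_mem_edgeSet (hx : x ∈ edgeSet (edge τ i)) :
    (hM.basis τ).coord i x = 0 := by
  obtain ⟨s, rfl⟩ := exists_eq_lineMap_of_mem_edgeSet hx
  rw [AffineMap.apply_lineMap, hM.coord_vert_ne (by simp), hM.coord_vert_ne (by simp),
    AffineMap.lineMap_same_apply]

lemma coord_mem_Icc (hx : x ∈ M.triSet τ) (i : Fin 3) :
    (hM.basis τ).coord i x ∈ Set.Icc (0 : ℝ) 1 := by
  have hnonneg := hM.mem_triSet.1 hx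
  refine ⟨hnonneg i, ?_⟩
  rw [← (hM.basis τ).sum_coord_apply_eq_one x]
  exact Finset.single_le_sum (fun j _ => hnonneg j) (Finset.mem_univ i)

lemma coord_refMap (τ : M.Tri) (i : Fin 3) (y : Pt) :
    (hM.basis τ).coord i (refMap (vert τ i) (vert τ (i + 1)) (vert τ (i + 2)) y) =
      1 - y 0 - y 1 := by
  rw [apply_refMap, hM.coord_vert_self, hM.coord_vert_ne (by simp), hM.coord_vert_ne (by simp)]
  ring

lemma edgeProj_refMap (τ : M.Tri) (i : Fin 3) (y : Pt) :
    hM.edgeProj τ i (refMap (vert τ i) (vert τ (i + 1)) (vert τ (i + 2)) y) =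
      AffineMap.lineMap (vert τ (i + 1)) (vert τ (i + 2)) (y 1) := by
  rw [edgeProj_apply, apply_refMap, hM.coord_vert_self, hM.coord_vert_ne (by simp),
    hM.coord_vert_ne (by simp)]
  congr 1
  ring

lemma integral_sq_le_mul_integral_coord {K : ℝ} (hK : 0 < K)
    (hbubble : ∀ p ∈ P k,
      ∫ x in refTri, pval p x ^ 2 ≤ K * ∫ x in refTri, bubble x * pval p x ^ 2)
    {p : MvPolynomial (Fin 2) ℝ} (hp : p ∈ P k) (τ : M.Tri) (i : Fin 3) :
    ∫ x in M.triSet τ, pval p x ^ 2 ≤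
      K * ∫ x in M.triSet τ, (hM.basis τ).coord i x * pval p x ^ 2 := by
  have hbubble_le : ∀ y ∈ refTri, bubble y ≤ 1 - y 0 - y 1 := fun y ⟨h0, h1, h2⟩ =>
    mul_le_of_le_one_left (by linarith) (mul_le_one₀ (by linarith) h1 (by linarith))
  rw [hM.integral_triSet τ i, hM.integral_triSet τ i, mul_left_comm]
  refine mul_le_mul_of_nonneg_left ?_ (abs_nonneg _)
  simp only [hM.coord_refMap]
  set F := refMap (vert τ i) (vert τ (i + 1)) (vert τ (i + 2))
  have hcont : Continuous F := F.continuous_of_finiteDimensional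
  have hF := hbubble _ (compAffine_mem_P hp F)
  simp only [pval_compAffine] at hF
  refine hF.trans (mul_le_mul_of_nonneg_left ?_ hK.le)
  exact setIntegral_mono_on (integrableOn_refTri (by fun_prop))
    (integrableOn_refTri (by fun_prop)) isClosed_refTri.measurableSet fun y hy =>
      mul_le_mul_of_nonneg_right (hbubble_le y hy) (sq_nonneg _)

lemma integral_comp_edgeProj_le {f : Pt → ℝ} (hf : Continuous f) (hn : ∀ x, 0 ≤ f x) (τ : M.Tri)
    (i : Fin 3) : ∫ x in M.triSet τ, f (hM.edgeProj τ i x) ≤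
      |jac τ| * ((edgeLength (edge τ i))⁻¹ * edgeIntegral f (edge τ i)) := by
  rw [hM.integral_triSet τ i]
  refine mul_le_mul_of_nonneg_left ?_ (abs_nonneg _)
  simp only [hM.edgeProj_refMap]
  refine (integral_refTri_comp_apply_le (hf.comp AffineMap.lineMap_continuous)
    (fun _ => hn _) 1).trans_eq ?_
  have hl := (hM.edgeLength_pos τ i).ne'
  rw [edge, edgeLength_mk] at hl
  rw [edge, edgeIntegral_mk, edgeLength_mk, inv_mul_cancel_left₀ hl]
  rfl

end IsMeshOf

end MeshData

/-! ### Fields with prescribed traces -/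

namespace MeshData

variable {M : MeshData} {Ω : Set Pt} {τ : M.Tri} {e : Sym2 Pt} {v : M.VField} {G : M.MField}
  {k : ℕ} {ρ c θ : ℝ} {m : Fin 4} {x : Pt}

lemma normalTrace_dotProduct_eq {w : Fin 2 → ℝ} {r : ℝ} (hne : (M.adj e).Nonempty)
    (h : ∀ τ ∈ M.adj e, (mval (G τ) x *ᵥ M.normal e) ⬝ᵥ w = r) :
    M.normalTrace G e x ⬝ᵥ w = r := by
  rw [normalTrace, smul_dotProduct, sum_dotProduct, Finset.sum_congr rfl h, Finset.sum_const,
    nsmul_eq_mul, smul_eq_mul, inv_mul_cancel_left₀ (Nat.cast_ne_zero.2 hne.card_pos.ne')]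

lemma normalTrace_eq {a : Fin 2 → ℝ} (hne : (M.adj e).Nonempty)
    (h : ∀ τ ∈ M.adj e, mval (G τ) x *ᵥ M.normal e = a) : M.normalTrace G e x = a := by
  ext i
  simpa only [dotProduct_single_one] using normalTrace_dotProduct_eq
    (w := Pi.single i 1) hne fun τ hτ => by rw [h τ hτ, dotProduct_single_one]

lemma jumpMixed_eq {r : ℝ}
    (h : ∀ τ ∈ M.adj e, (mval (G τ) x *ᵥ M.normal e) ⬝ᵥ M.tangent e = r) :
    M.jumpMixed G v e x = (M.jump v e x ⬝ᵥ M.tangent e) * r := by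
  rw [jumpMixed, jump_dotProduct, Finset.sum_mul]
  refine Finset.sum_congr rfl fun τ hτ => ?_
  rw [smul_dotProduct, dotProduct_comm (M.tangent e), h τ hτ, smul_eq_mul, mul_assoc]

/-- The degrees of freedom of `G` in `Ŵ^h`, namely `G n` on the primal edges and `(G n) ⬝ t` on the
dual ones, are `-h_e⁻¹` times the jumps of `v`, respectively their tangential components. -/
structure HasJumpTraces (G : M.MField) (v : M.VField) : Prop where
  mulVec_normal : ∀ e ∈ M.Fu, ∀ τ ∈ M.adj e, ∀ x ∈ edgeSet e,
    mval (G τ) x *ᵥ M.normal e = -(edgeLength e)⁻¹ • M.jump v e x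
  mulVec_normal_dot_tangent : ∀ e ∈ M.Fp, ∀ τ ∈ M.adj e, ∀ x ∈ edgeSet e,
    (mval (G τ) x *ᵥ M.normal e) ⬝ᵥ M.tangent e =
      -(edgeLength e)⁻¹ * (M.jump v e x ⬝ᵥ M.tangent e)

lemma edgeLength_mul_edgeIntegral_eq {f g : Pt → ℝ} (hl : 0 < edgeLength e)
    (h : ∀ x ∈ edgeSet e, f x = (edgeLength e)⁻¹ ^ 2 * g x) :
    edgeLength e * edgeIntegral f e = (edgeLength e)⁻¹ * edgeIntegral g e := by
  rw [edgeIntegral_congr h, edgeIntegral_const_mul]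
  field_simp

lemma adj_nonempty_of_mem_Fu (he : e ∈ M.Fu) : (M.adj e).Nonempty := by
  obtain ⟨τ, hτ⟩ := mem_Fu.1 he
  exact ⟨τ, mem_adj.2 ⟨0, hτ⟩⟩

lemma adj_nonempty_of_mem_Fp (he : e ∈ M.Fp) : (M.adj e).Nonempty := by
  obtain ⟨τ, hτ⟩ := mem_Fp.1 he
  exact ⟨τ, mem_adj.2 ⟨2, hτ⟩⟩

namespace IsMeshOf

variable (hM : M.IsMeshOf Ω)
include hM

lemma edgeLength_pos_of_mem_adj (h : τ ∈ M.adj e) : 0 < edgeLength e := by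
  obtain ⟨i, rfl⟩ := mem_adj.1 h
  exact hM.edgeLength_pos τ i

lemma jump_dot_self (hv : v ∈ M.U k) (he : e ∈ M.Fp) (hx : x ∈ edgeSet e) :
    M.jump v e x ⬝ᵥ M.jump v e x = (M.jump v e x ⬝ᵥ M.tangent e) ^ 2 := by
  obtain ⟨τ, hτ⟩ := adj_nonempty_of_mem_Fp he
  have htan := eq_tangent_of_dot_normal_eq_zero (hM.normal_dot_self hτ)
    (hM.jump_dot_normal_eq_zero hv he hx)
  nth_rewrite 2 [htan]
  rw [dotProduct_smul, smul_eq_mul, sq]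

end IsMeshOf

namespace HasJumpTraces

variable (hG : HasJumpTraces G v)
include hG

lemma mem_WHat (hM : M.IsMeshOf Ω) (hP : ∀ τ i j, G τ i j ∈ P k) : G ∈ M.WHat Ω k := by
  refine ⟨⟨hP, fun e he _ τ hτ τ' hτ' x hx => ?_⟩, fun w hw e he => ?_⟩
  · rw [hG.mulVec_normal e he τ hτ x hx, hG.mulVec_normal e he τ' hτ' x hx]
  · have hzero : ∀ x ∈ edgeSet e, M.jumpNormal G e x ⬝ᵥ vval (w e) x = 0 := fun x hx => by
      obtain ⟨τ₀, hτ₀⟩ := adj_nonempty_of_mem_Fp he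
      rw [eq_tangent_of_dot_normal_eq_zero (hM.normal_dot_self hτ₀) ((hw e he).2 x hx),
        dotProduct_smul, jumpNormal, sum_dotProduct, Finset.sum_congr rfl fun τ hτ => by
          rw [smul_dotProduct, hG.mulVec_normal_dot_tangent e he τ hτ x hx],
        ← Finset.sum_smul, hM.sum_sgn_eq_zero he, zero_smul, smul_zero]
    rw [edgeIntegral_congr hzero, edgeIntegral_const, mul_zero]

variable (hM : M.IsMeshOf Ω) (hv : v ∈ M.U k)
include hM hv

lemma B_eq : M.B G v =
    (∑ τ, ∫ x in M.triSet τ, frob (mval (G τ) x) (mval (grad (v τ)) x)) + jumpPart v := by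
  have hFu : ∀ e ∈ M.Fu, edgeIntegral (fun x => M.jump v e x ⬝ᵥ M.normalTrace G e x) e =
      -jumpTerm v e := fun e he => by
    rw [jumpTerm, ← neg_mul, ← edgeIntegral_const_mul]
    refine edgeIntegral_congr fun x hx => ?_
    rw [normalTrace_eq (adj_nonempty_of_mem_Fu he)
      fun τ hτ => hG.mulVec_normal e he τ hτ x hx, dotProduct_smul, smul_eq_mul]
  have hFp : ∀ e ∈ M.Fp, edgeIntegral (M.jumpMixed G v e) e = -jumpTerm v e := fun e he => by
    rw [jumpTerm, ← neg_mul, ← edgeIntegral_const_mul]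
    refine edgeIntegral_congr fun x hx => ?_
    rw [jumpMixed_eq fun τ hτ => hG.mulVec_normal_dot_tangent e he τ hτ x hx,
      hM.jump_dot_self hv he hx]
    ring
  rw [B, Finset.sum_congr rfl hFu, Finset.sum_congr rfl hFp, Finset.sum_neg_distrib,
    Finset.sum_neg_distrib, jumpPart]
  ring

lemma normX'_eq : M.normX' G = √(l2Sq G + jumpPart v) := by
  have hFu : ∀ e ∈ M.Fu, edgeLength e *
      edgeIntegral (fun x => M.normalTrace G e x ⬝ᵥ M.normalTrace G e x) e = jumpTerm v e := by
    intro e he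
    obtain ⟨τ₀, hτ₀⟩ := adj_nonempty_of_mem_Fu he
    refine edgeLength_mul_edgeIntegral_eq (hM.edgeLength_pos_of_mem_adj hτ₀) fun x hx => ?_
    rw [normalTrace_eq ⟨τ₀, hτ₀⟩ fun τ hτ => hG.mulVec_normal e he τ hτ x hx, dotProduct_smul,
      smul_dotProduct, smul_eq_mul, smul_eq_mul]
    ring
  have hFp : ∀ e ∈ M.Fp, edgeLength e *
      edgeIntegral (fun x => (M.normalTrace G e x ⬝ᵥ M.tangent e) ^ 2) e = jumpTerm v e := by
    intro e he
    obtain ⟨τ₀, hτ₀⟩ := adj_nonempty_of_mem_Fp he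
    refine edgeLength_mul_edgeIntegral_eq (hM.edgeLength_pos_of_mem_adj hτ₀) fun x hx => ?_
    rw [normalTrace_dotProduct_eq ⟨τ₀, hτ₀⟩
      fun τ hτ => hG.mulVec_normal_dot_tangent e he τ hτ x hx, hM.jump_dot_self hv he hx]
    ring
  rw [normX', Finset.sum_congr rfl hFu, Finset.sum_congr rfl hFp, add_assoc]
  rfl

end HasJumpTraces

end MeshData

/-! ### The test field -/

namespace MeshData

variable {M : MeshData} {Ω : Set Pt} {τ : M.Tri} {v : M.VField} {k : ℕ} {ρ c θ : ℝ} {m : Fin 4}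
  {x : Pt}

/-- The edge of a triangle that carries the `m`-th degree of freedom of `dualFun`. -/
def dofEdge : Fin 4 → Fin 3 := ![0, 0, 2, 1]

/-- The direction whose product with the trace `G n` on `dofEdge m` is the `m`-th degree of freedom
of `dualFun`. -/
def dofDir (τ : M.Tri) : Fin 4 → Fin 2 → ℝ :=
  ![Pi.single 0 1, Pi.single 1 1, M.tangent (edge τ 2), M.tangent (edge τ 1)]

lemma dofDir_dot_mulVec_normal (τ : M.Tri) (m : Fin 4) (X : Matrix (Fin 2) (Fin 2) ℝ) :
    dofDir τ m ⬝ᵥ (X *ᵥ M.normal (edge τ (dofEdge m))) =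
      dualFun (M.normal (edge τ 0)) (M.normal (edge τ 2)) (M.normal (edge τ 1)) X m := by
  fin_cases m
  · exact single_one_dotProduct _ _
  · exact single_one_dotProduct _ _
  · rfl
  · rfl

/-- The basis of the constant matrices on a triangle that is dual to `dualFun`. -/
noncomputable def dualBasis (τ : M.Tri) : Fin 4 → Matrix (Fin 2) (Fin 2) ℝ :=
  dualMatrix (M.normal (edge τ 0)) (M.normal (edge τ 2)) (M.normal (edge τ 1))
    (M.va τ - M.vc τ).ofLp (M.vb τ - M.vc τ).ofLp

/-- The component of the jump of `v` on `dofEdge m` in the direction `dofDir m`. -/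
noncomputable def jumpDof (v : M.VField) (τ : M.Tri) (m : Fin 4) : MvPolynomial (Fin 2) ℝ :=
  ∑ j, C (dofDir τ m j) * ∑ σ ∈ M.adj (edge τ (dofEdge m)),
    C (M.sgn σ (edge τ (dofEdge m))) * v σ j

lemma pval_jumpDof (v : M.VField) (τ : M.Tri) (m : Fin 4) (x : Pt) :
    pval (jumpDof v τ m) x = dofDir τ m ⬝ᵥ M.jump v (edge τ (dofEdge m)) x := by
  simp only [jumpDof, dotProduct, jump, pval_sum, pval_mul, pval_C, Finset.sum_apply,
    Pi.smul_apply, smul_eq_mul, vval]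

lemma jumpDof_mem_P (hv : v ∈ M.U k) (τ : M.Tri) (m : Fin 4) : jumpDof v τ m ∈ P k :=
  (P k).sum_mem fun j _ => C_mul_mem_P ((P k).sum_mem fun σ _ => C_mul_mem_P (hv.1 σ j) _) _

/-- The contribution of the `m`-th degree of freedom of a triangle to the jump terms of its
edges. -/
noncomputable def jumpShare (v : M.VField) (τ : M.Tri) (m : Fin 4) : ℝ :=
  (edgeLength (edge τ (dofEdge m)))⁻¹ *
    edgeIntegral (fun x => pval (jumpDof v τ m) x ^ 2) (edge τ (dofEdge m))

lemma jumpShare_nonneg (v : M.VField) (τ : M.Tri) (m : Fin 4) : 0 ≤ jumpShare v τ m :=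
  mul_nonneg (inv_nonneg.2 (edgeLength_nonneg _)) (edgeIntegral_nonneg _ fun _ => sq_nonneg _)

namespace IsMeshOf

variable (hM : M.IsMeshOf Ω)

/-- The extension of the scaled jump `-h_e⁻¹ [v]`, in the `m`-th degree of freedom, from its edge to
the triangle. -/
noncomputable def liftPoly (v : M.VField) (τ : M.Tri) (m : Fin 4) : MvPolynomial (Fin 2) ℝ :=
  C (-(edgeLength (edge τ (dofEdge m)))⁻¹) *
    compAffine (jumpDof v τ m) (hM.edgeProj τ (dofEdge m))

/-- The coefficient of the test field at the `m`-th dual matrix. The first term gives it the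
prescribed trace; the second one vanishes on the edge and tests `∇_h v` inside the triangle. -/
noncomputable def coefPoly (θ : ℝ) (v : M.VField) (τ : M.Tri) (m : Fin 4) :
    MvPolynomial (Fin 2) ℝ :=
  hM.liftPoly v τ m +
    C θ * (affinePoly ((hM.basis τ).coord (dofEdge m)) * contract (dualBasis τ m) (v τ))

/-- The matrix field against which `v` is tested in the inf-sup condition. -/
noncomputable def testField (θ : ℝ) (v : M.VField) : M.MField := fun τ =>
  Matrix.of fun i j => ∑ m, C (dualBasis τ m i j) * hM.coefPoly θ v τ m

lemma pval_coefPoly (θ : ℝ) (v : M.VField) (τ : M.Tri) (m : Fin 4) (x : Pt) :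
    pval (hM.coefPoly θ v τ m) x = pval (hM.liftPoly v τ m) x +
      θ * ((hM.basis τ).coord (dofEdge m) x * pval (contract (dualBasis τ m) (v τ)) x) := by
  rw [coefPoly, pval_add, pval_mul (C θ), pval_C, pval_mul, pval_affinePoly]

lemma pval_coefPoly_of_mem_edgeSet (hx : x ∈ edgeSet (edge τ (dofEdge m))) :
    pval (hM.coefPoly θ v τ m) x = -(edgeLength (edge τ (dofEdge m)))⁻¹ *
      (dofDir τ m ⬝ᵥ M.jump v (edge τ (dofEdge m)) x) := by
  rw [pval_coefPoly, hM.coord_eq_zero_of_mem_edgeSet hx, zero_mul, mul_zero, add_zero, liftPoly,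
    pval_mul, pval_C, pval_compAffine, hM.edgeProj_eq_self hx, pval_jumpDof]

lemma mval_testField (θ : ℝ) (v : M.VField) (τ : M.Tri) (x : Pt) :
    mval (hM.testField θ v τ) x = ∑ m, pval (hM.coefPoly θ v τ m) x • dualBasis τ m := by
  ext i j
  simp only [mval, testField, Matrix.of_apply, pval_sum, pval_mul, pval_C, Matrix.sum_apply,
    Matrix.smul_apply, smul_eq_mul, mul_comm]

lemma testField_mem_P (hv : v ∈ M.U k) (τ : M.Tri) (i j : Fin 2) :
    hM.testField θ v τ i j ∈ P k := by
  rw [testField, Matrix.of_apply]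
  refine (P k).sum_mem fun m _ => C_mul_mem_P ((P k).add_mem ?_ ?_) _
  · exact C_mul_mem_P (compAffine_mem_P (jumpDof_mem_P hv τ m) _) _
  · exact C_mul_mem_P (mul_contract_mem_P _ (affinePoly_mem_P _) (hv.1 τ)) _

include hM in
lemma sum_jumpShare (hv : v ∈ M.U k) (τ : M.Tri) :
    ∑ m, jumpShare v τ m = ∑ i, jumpTerm v (edge τ i) := by
  have htan : ∀ i, i ≠ 0 → jumpTerm v (edge τ i) = (edgeLength (edge τ i))⁻¹ *
      edgeIntegral (fun x => (M.tangent (edge τ i) ⬝ᵥ M.jump v (edge τ i) x) ^ 2) (edge τ i) :=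
    fun i hi => by
      rw [jumpTerm, edgeIntegral_congr fun x hx => by
        rw [hM.jump_dot_self hv (edge_mem_Fp τ hi) hx, dotProduct_comm]]
  have hside : jumpTerm v (edge τ 0) = jumpShare v τ 0 + jumpShare v τ 1 := by
    have hsplit : ∀ x, M.jump v (edge τ 0) x ⬝ᵥ M.jump v (edge τ 0) x =
        pval (jumpDof v τ 0) x ^ 2 + pval (jumpDof v τ 1) x ^ 2 := fun x => by
      simp only [pval_jumpDof, dofDir, dofEdge, Matrix.cons_val, single_one_dotProduct, sq]
      exact Fin.sum_univ_two _
    simp only [jumpTerm, hsplit]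
    rw [edgeIntegral_add _ (by fun_prop) (by fun_prop), mul_add]
    rfl
  rw [Fin.sum_univ_four, Fin.sum_univ_three, hside, htan 1 (by decide), htan 2 (by decide)]
  simp only [jumpShare, pval_jumpDof]
  simp only [dofEdge, dofDir, Matrix.cons_val]
  ring

variable (hR : M.IsRegular ρ c) (hρ : 0 < ρ) (hc : 0 < c)
include hR hρ hc

lemma dofDir_dot_testField_mulVec (hx : x ∈ edgeSet (edge τ (dofEdge m))) :
    dofDir τ m ⬝ᵥ (mval (hM.testField θ v τ) x *ᵥ M.normal (edge τ (dofEdge m))) =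
      -(edgeLength (edge τ (dofEdge m)))⁻¹ *
        (dofDir τ m ⬝ᵥ M.jump v (edge τ (dofEdge m)) x) := by
  rw [dofDir_dot_mulVec_normal, mval_testField, dualBasis,
    (hM.shapeRegular hR hρ hc τ).dualFun_sum_dualMatrix, hM.pval_coefPoly_of_mem_edgeSet hx]

lemma hasJumpTraces_testField (θ : ℝ) (v : M.VField) :
    HasJumpTraces (hM.testField θ v) v where
  mulVec_normal e he τ hτ x hx := by
    obtain ⟨i, rfl⟩ := mem_adj.1 hτ
    obtain rfl := (hM.edge_mem_Fu_iff hR hρ).1 he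
    have h₀ := hM.dofDir_dot_testField_mulVec hR hρ hc (θ := θ) (v := v) (m := 0) hx
    have h₁ := hM.dofDir_dot_testField_mulVec hR hρ hc (θ := θ) (v := v) (m := 1) hx
    ext j
    fin_cases j
    · simpa [dofDir, dofEdge] using h₀
    · simpa [dofDir, dofEdge] using h₁
  mulVec_normal_dot_tangent e he τ hτ x hx := by
    obtain ⟨i, rfl⟩ := mem_adj.1 hτ
    have hi := (hM.edge_mem_Fp_iff hR hρ).1 he
    rw [dotProduct_comm, dotProduct_comm (M.jump v _ x)]
    obtain rfl | rfl : i = 1 ∨ i = 2 := by omega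
    · exact hM.dofDir_dot_testField_mulVec hR hρ hc (m := 3) hx
    · exact hM.dofDir_dot_testField_mulVec hR hρ hc (m := 2) hx

end IsMeshOf

end MeshData

/-! ### The inf-sup condition -/

namespace MeshData

variable {M : MeshData} {Ω : Set Pt} {v : M.VField} {k : ℕ} {ρ c θ δ K : ℝ}

lemma B_zero (v : M.VField) : M.B 0 v = 0 := by
  have hmval : ∀ x, mval (0 : Matrix (Fin 2) (Fin 2) (MvPolynomial (Fin 2) ℝ)) x = 0 := fun x => by
    ext
    exact pval_zero x
  simp [B, hmval, frob, normalTrace, jumpMixed, edgeIntegral_const]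

namespace IsMeshOf

variable (hM : M.IsMeshOf Ω)
include hM

section InnerProduct

lemma frob_testField_grad (θ : ℝ) (v : M.VField) (τ : M.Tri) (x : Pt) :
    frob (mval (hM.testField θ v τ) x) (mval (grad (v τ)) x) =
      ∑ m, (pval (hM.liftPoly v τ m) x * pval (contract (dualBasis τ m) (v τ)) x +
        θ * ((hM.basis τ).coord (dofEdge m) x * pval (contract (dualBasis τ m) (v τ)) x ^ 2)) := by
  rw [hM.mval_testField, frob_sum_smul_left]
  refine Finset.sum_congr rfl fun m _ => ?_
  rw [pval_coefPoly, ← pval_contract]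
  ring

omit hM in
lemma neg_integral_sq_sub_le_integral_mul {f g : Pt → ℝ} (hf : Continuous f) (hg : Continuous g)
    (hδ : 0 < δ) (τ : M.Tri) :
    -(4 * δ)⁻¹ * (∫ x in M.triSet τ, f x ^ 2) - δ * ∫ x in M.triSet τ, g x ^ 2 ≤
      ∫ x in M.triSet τ, f x * g x := by
  rw [← integral_const_mul, ← integral_const_mul,
    ← integral_sub (integrableOn_triSet (by fun_prop) τ) (integrableOn_triSet (by fun_prop) τ)]
  refine setIntegral_mono (integrableOn_triSet (by fun_prop) τ)
    (integrableOn_triSet (by fun_prop) τ) fun x => sub_nonneg.1 ?_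
  have hsq : f x * g x - (-(4 * δ)⁻¹ * f x ^ 2 - δ * g x ^ 2) =
      (4 * δ)⁻¹ * (f x + 2 * δ * g x) ^ 2 := by
    field_simp
    ring
  rw [hsq]
  positivity

lemma le_integral_frob_testField_grad (hK : 0 < K)
    (hbubble : ∀ p ∈ P k,
      ∫ x in refTri, pval p x ^ 2 ≤ K * ∫ x in refTri, bubble x * pval p x ^ 2)
    (hv : v ∈ M.U k) (hδ : 0 < δ) (hθ : 0 ≤ θ) (τ : M.Tri) :
    (θ / K - δ) * (∑ m, ∫ x in M.triSet τ, pval (contract (dualBasis τ m) (v τ)) x ^ 2) -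
        (4 * δ)⁻¹ * ∑ m, ∫ x in M.triSet τ, pval (hM.liftPoly v τ m) x ^ 2 ≤
      ∫ x in M.triSet τ, frob (mval (hM.testField θ v τ) x) (mval (grad (v τ)) x) := by
  have hcoord : ∀ i, Continuous ((hM.basis τ).coord i) := fun i =>
    ((hM.basis τ).coord i).continuous_of_finiteDimensional
  simp only [hM.frob_testField_grad]
  rw [integral_finsetSum _ fun m _ => integrableOn_triSet (by fun_prop) τ, Finset.mul_sum,
    Finset.mul_sum, ← Finset.sum_sub_distrib]
  refine Finset.sum_le_sum fun m _ => ?_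
  rw [integral_add (integrableOn_triSet (by fun_prop) τ) (integrableOn_triSet (by fun_prop) τ),
    integral_const_mul]
  have hyoung := neg_integral_sq_sub_le_integral_mul (f := pval (hM.liftPoly v τ m))
    (g := pval (contract (dualBasis τ m) (v τ))) (by fun_prop) (by fun_prop) hδ τ
  have hcoercive := mul_le_mul_of_nonneg_left (hM.integral_sq_le_mul_integral_coord hK hbubble
    (contract_mem_P (dualBasis τ m) (hv.1 τ)) τ (dofEdge m)) (div_nonneg hθ hK.le)
  rw [← mul_assoc, div_mul_cancel₀ _ hK.ne'] at hcoercive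
  linarith

end InnerProduct

lemma pval_coefPoly_sq_le {τ : M.Tri} {x : Pt} (hx : x ∈ M.triSet τ) (m : Fin 4) :
    pval (hM.coefPoly θ v τ m) x ^ 2 ≤ 2 * (pval (hM.liftPoly v τ m) x ^ 2 +
      θ ^ 2 * pval (contract (dualBasis τ m) (v τ)) x ^ 2) := by
  obtain ⟨h₀, h₁⟩ := hM.coord_mem_Icc hx (dofEdge m)
  rw [pval_coefPoly, mul_left_comm, ← mul_pow]
  refine (add_sq_le).trans ?_
  rw [mul_pow (AffineBasis.coord _ _ _)]
  gcongr
  exact mul_le_of_le_one_left (sq_nonneg _) (pow_le_one₀ h₀ h₁)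

lemma frob_testField_self_le {D : ℝ} {τ : M.Tri}
    (hD : ∀ m, frob (dualBasis τ m) (dualBasis τ m) ≤ D) {x : Pt} (hx : x ∈ M.triSet τ) :
    frob (mval (hM.testField θ v τ) x) (mval (hM.testField θ v τ) x) ≤
      8 * D * ∑ m, (pval (hM.liftPoly v τ m) x ^ 2 +
        θ ^ 2 * pval (contract (dualBasis τ m) (v τ)) x ^ 2) := by
  rw [mval_testField]
  calc _ ≤ _ := frob_sum_smul_self_le _ _
    _ ≤ (∑ m, 2 * (pval (hM.liftPoly v τ m) x ^ 2 +
        θ ^ 2 * pval (contract (dualBasis τ m) (v τ)) x ^ 2)) * ∑ _m : Fin 4, D :=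
      mul_le_mul (Finset.sum_le_sum fun m _ => hM.pval_coefPoly_sq_le hx m)
        (Finset.sum_le_sum fun m _ => hD m) (Finset.sum_nonneg fun m _ => frob_self_nonneg _)
        (Finset.sum_nonneg fun m _ => by positivity)
    _ = _ := by
      rw [← Finset.mul_sum, Finset.sum_const, Finset.card_univ, Fintype.card_fin, nsmul_eq_mul]
      push_cast
      ring

lemma integral_frob_testField_self_le {D : ℝ} {τ : M.Tri}
    (hD : ∀ m, frob (dualBasis τ m) (dualBasis τ m) ≤ D) :
    ∫ x in M.triSet τ, frob (mval (hM.testField θ v τ) x) (mval (hM.testField θ v τ) x) ≤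
      8 * D * ((∑ m, ∫ x in M.triSet τ, pval (hM.liftPoly v τ m) x ^ 2) +
        θ ^ 2 * ∑ m, ∫ x in M.triSet τ, pval (contract (dualBasis τ m) (v τ)) x ^ 2) := by
  refine (setIntegral_mono_on (integrableOn_triSet (by fun_prop) τ)
    (integrableOn_triSet (by fun_prop) τ) (isCompact_triSet τ).measurableSet
    fun x hx => hM.frob_testField_self_le hD hx).trans_eq ?_
  rw [integral_const_mul, integral_finsetSum _ fun m _ => integrableOn_triSet (by fun_prop) τ,
    Finset.mul_sum _ _ (θ ^ 2), ← Finset.sum_add_distrib]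
  congr 1
  refine Finset.sum_congr rfl fun m _ => ?_
  rw [integral_add (integrableOn_triSet (by fun_prop) τ) (integrableOn_triSet (by fun_prop) τ),
    integral_const_mul]

variable (hR : M.IsRegular ρ c) (hρ : 0 < ρ) (hc : 0 < c)
include hR hρ hc

lemma integral_liftPoly_sq_le (v : M.VField) (τ : M.Tri) (m : Fin 4) :
    ∫ x in M.triSet τ, pval (hM.liftPoly v τ m) x ^ 2 ≤ (ρ * c)⁻¹ * jumpShare v τ m := by
  set l := edgeLength (edge τ (dofEdge m)) with hl
  have hl₀ : 0 < l := hM.edgeLength_pos τ (dofEdge m)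
  have hproj := hM.integral_comp_edgeProj_le (f := fun x => pval (jumpDof v τ m) x ^ 2)
    (by fun_prop) (fun _ => sq_nonneg _) τ (dofEdge m)
  simp only [liftPoly, pval_mul, pval_C, pval_compAffine, mul_pow, neg_sq]
  rw [integral_const_mul, ← hl]
  calc l⁻¹ ^ 2 * ∫ x in M.triSet τ, pval (jumpDof v τ m) (hM.edgeProj τ (dofEdge m) x) ^ 2
      ≤ l⁻¹ ^ 2 * ((ρ * c)⁻¹ * l ^ 2 * jumpShare v τ m) := by
        refine mul_le_mul_of_nonneg_left (hproj.trans ?_) (by positivity)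
        exact mul_le_mul_of_nonneg_right (hM.abs_jac_le hR hρ hc τ _) (jumpShare_nonneg v τ m)
    _ = (ρ * c)⁻¹ * jumpShare v τ m := by field_simp

lemma sum_integral_liftPoly_sq_le (hv : v ∈ M.U k) (τ : M.Tri) :
    ∑ m, ∫ x in M.triSet τ, pval (hM.liftPoly v τ m) x ^ 2 ≤
      (ρ * c)⁻¹ * ∑ i, jumpTerm v (edge τ i) := by
  rw [← hM.sum_jumpShare hv, Finset.mul_sum]
  exact Finset.sum_le_sum fun m _ => hM.integral_liftPoly_sq_le hR hρ hc v τ m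

lemma integral_frob_grad_self_le (v : M.VField) (τ : M.Tri) :
    ∫ x in M.triSet τ, frob (mval (grad (v τ)) x) (mval (grad (v τ)) x) ≤
      3 * ∑ m, ∫ x in M.triSet τ, pval (contract (dualBasis τ m) (v τ)) x ^ 2 := by
  rw [← integral_finsetSum _ fun m _ => integrableOn_triSet (by fun_prop) τ, ← integral_const_mul]
  refine setIntegral_mono (integrableOn_triSet (by fun_prop) τ)
    (integrableOn_triSet (by fun_prop) τ) fun x => ?_
  simp only [pval_contract]
  exact (hM.shapeRegular hR hρ hc τ).frob_self_le_sum_frob_dualMatrix_sq _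

lemma sum_integral_contract_sq_le (v : M.VField) (τ : M.Tri) :
    ∑ m, ∫ x in M.triSet τ, pval (contract (dualBasis τ m) (v τ)) x ^ 2 ≤
      4 * dualBound (ρ * c) *
        ∫ x in M.triSet τ, frob (mval (grad (v τ)) x) (mval (grad (v τ)) x) := by
  have hterm : ∀ m, ∫ x in M.triSet τ, pval (contract (dualBasis τ m) (v τ)) x ^ 2 ≤
      dualBound (ρ * c) *
        ∫ x in M.triSet τ, frob (mval (grad (v τ)) x) (mval (grad (v τ)) x) := fun m => by
    rw [← integral_const_mul]
    refine setIntegral_mono (integrableOn_triSet (by fun_prop) τ)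
      (integrableOn_triSet (by fun_prop) τ) fun x => ?_
    simp only [pval_contract]
    exact (frob_sq_le _ _).trans (mul_le_mul_of_nonneg_right
      ((hM.shapeRegular hR hρ hc τ).frob_dualMatrix_le m) (frob_self_nonneg _))
  refine (Finset.sum_le_card_nsmul _ _ _ fun m _ => hterm m).trans_eq ?_
  rw [Finset.card_univ, Fintype.card_fin, nsmul_eq_mul, mul_assoc]
  rfl

lemma normZ2_sq_le_two_mul_B_testField (hK : 0 < K)
    (hbubble : ∀ p ∈ P k,
      ∫ x in refTri, pval p x ^ 2 ≤ K * ∫ x in refTri, bubble x * pval p x ^ 2)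
    (hv : v ∈ M.U k) (hθ : θ = K * ((ρ * c)⁻¹ + 3 / 2)) :
    M.normZ2 v ^ 2 ≤ 2 * M.B (hM.testField θ v) v := by
  have hδ : 0 < (ρ * c)⁻¹ := inv_pos.2 (mul_pos hρ hc)
  have hθK : θ / K - (ρ * c)⁻¹ = 3 / 2 := by
    rw [hθ]
    field_simp
    ring
  have hlocal : ∀ τ, 1 / 2 * (∫ x in M.triSet τ, frob (mval (grad (v τ)) x) (mval (grad (v τ)) x))
      - 1 / 4 * ∑ i, jumpTerm v (edge τ i) ≤
        ∫ x in M.triSet τ, frob (mval (hM.testField θ v τ) x) (mval (grad (v τ)) x) := fun τ => by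
    have hlower := hM.le_integral_frob_testField_grad hK hbubble hv hδ (θ := θ)
      (by rw [hθ]; positivity) τ
    have hgrad := hM.integral_frob_grad_self_le hR hρ hc v τ
    have hlift : (4 * (ρ * c)⁻¹)⁻¹ * ∑ m, ∫ x in M.triSet τ, pval (hM.liftPoly v τ m) x ^ 2 ≤
        1 / 4 * ∑ i, jumpTerm v (edge τ i) := by
      rw [inv_mul_le_iff₀ (by positivity)]
      linarith [hM.sum_integral_liftPoly_sq_le hR hρ hc hv τ]
    rw [hθK] at hlower
    linarith
  have hglobal := Finset.sum_le_sum fun τ (_ : τ ∈ Finset.univ) => hlocal τ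
  rw [Finset.sum_sub_distrib, ← Finset.mul_sum, ← Finset.mul_sum] at hglobal
  change 1 / 2 * l2Sq (gradField v) - _ ≤ _ at hglobal
  rw [hM.normZ2_eq hv, Real.sq_sqrt (add_nonneg (l2Sq_nonneg _) (jumpPart_nonneg v)),
    (hM.hasJumpTraces_testField hR hρ hc θ v).B_eq hM hv]
  linarith [hM.sum_jumpTerm_edge_le v]

lemma normX'_testField_le (θ : ℝ) (hv : v ∈ M.U k) : M.normX' (hM.testField θ v) ≤
    √(8 * dualBound (ρ * c) * (2 * (ρ * c)⁻¹ + 4 * θ ^ 2 * dualBound (ρ * c)) + 1) *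
      M.normZ2 v := by
  have : 0 < (ρ * c)⁻¹ := inv_pos.2 (mul_pos hρ hc)
  have hD : 0 < dualBound (ρ * c) := dualBound_pos (mul_pos hρ hc)
  have hlocal : ∀ τ : M.Tri,
      ∫ x in M.triSet τ, frob (mval (hM.testField θ v τ) x) (mval (hM.testField θ v τ) x) ≤
      8 * dualBound (ρ * c) * ((ρ * c)⁻¹ * ∑ i, jumpTerm v (edge τ i) +
        θ ^ 2 * (4 * dualBound (ρ * c) *
          ∫ x in M.triSet τ, frob (mval (grad (v τ)) x) (mval (grad (v τ)) x))) := fun τ => by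
    refine (hM.integral_frob_testField_self_le
      (hM.shapeRegular hR hρ hc τ).frob_dualMatrix_le).trans ?_
    gcongr
    · exact hM.sum_integral_liftPoly_sq_le hR hρ hc hv τ
    · exact hM.sum_integral_contract_sq_le hR hρ hc v τ
  have hglobal := Finset.sum_le_sum fun τ (_ : τ ∈ Finset.univ) => hlocal τ
  simp only [← Finset.mul_sum, Finset.sum_add_distrib] at hglobal
  change l2Sq (hM.testField θ v) ≤ 8 * _ * (_ + θ ^ 2 * (_ * l2Sq (gradField v))) at hglobal
  have hjump := hM.sum_jumpTerm_edge_le v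
  have hg := l2Sq_nonneg (gradField v)
  have hJ := jumpPart_nonneg v
  rw [hM.normZ2_eq hv, (hM.hasJumpTraces_testField hR hρ hc θ v).normX'_eq hM hv,
    ← Real.sqrt_mul (by positivity)]
  refine Real.sqrt_le_sqrt ?_
  set D := dualBound (ρ * c)
  set g := l2Sq (gradField v)
  set J := jumpPart v
  calc l2Sq (hM.testField θ v) + J
      ≤ 8 * D * ((ρ * c)⁻¹ * (2 * J) + θ ^ 2 * (4 * D * g)) + J := by
        refine add_le_add_left (hglobal.trans ?_) J
        gcongr
    _ ≤ (8 * D * (2 * (ρ * c)⁻¹ + 4 * θ ^ 2 * D) + 1) * (g + J) := by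
        have hDg : 0 ≤ D * (ρ * c)⁻¹ * g := by positivity
        have hDJ : 0 ≤ D * (θ ^ 2 * D) * J := by positivity
        linarith

end IsMeshOf

lemma exists_normZ2_sq_le_B_and_normX'_le (k : ℕ) (hρ : 0 < ρ) (hc : 0 < c) :
    ∃ K > 0, ∀ (Ω : Set Pt) (M : MeshData), M.IsMeshOf Ω → M.IsRegular ρ c →
      ∀ v ∈ M.U k, ∃ G ∈ M.WHat Ω k, M.normZ2 v ^ 2 ≤ 2 * M.B G v ∧
        M.normX' G ≤ K * M.normZ2 v := by
  obtain ⟨K, hK, hbubble⟩ := exists_integral_sq_le_integral_bubble k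
  have hρc := mul_pos hρ hc
  have hD := dualBound_pos hρc
  set θ := K * ((ρ * c)⁻¹ + 3 / 2)
  refine ⟨√(8 * dualBound (ρ * c) * (2 * (ρ * c)⁻¹ + 4 * θ ^ 2 * dualBound (ρ * c)) + 1),
    Real.sqrt_pos.2 (by positivity), fun Ω M hM hR v hv => ⟨hM.testField θ v,
      (hM.hasJumpTraces_testField hR hρ hc θ v).mem_WHat hM fun τ => hM.testField_mem_P hv τ,
      hM.normZ2_sq_le_two_mul_B_testField hR hρ hc hK hbubble hv rfl,
      hM.normX'_testField_le hR hρ hc θ hv⟩⟩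

end MeshData

end SDG

theorem theorem3p1_general (k : ℕ) (ρ c : ℝ) (hρ : 0 < ρ) (hc : 0 < c) :
    ∃ C : ℝ, 0 < C ∧
      ∀ (Ω : Set SDG.Pt) (M : SDG.MeshData), M.IsMeshOf Ω → M.IsRegular ρ c →
        (C : EReal) ≤
          ⨅ v ∈ {v : M.VField | v ∈ M.U k ∧ v ≠ 0},
            ⨆ G ∈ {G : M.MField | G ∈ M.WHat Ω k ∧ G ≠ 0},
              ((M.B G v / (M.normX' G * M.normZ2 v) : ℝ) : EReal) := by
  obtain ⟨K, hK, htest⟩ := SDG.MeshData.exists_normZ2_sq_le_B_and_normX'_le k hρ hc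
  refine ⟨(2 * K)⁻¹, by positivity, fun Ω M hM hR => le_iInf₂ fun v ⟨hv, hv₀⟩ => ?_⟩
  obtain ⟨G, hG, hB, hX⟩ := htest Ω M hM hR v hv
  have hZ := hM.normZ2_pos hv hv₀
  have hG₀ : G ≠ 0 := by
    rintro rfl
    rw [SDG.MeshData.B_zero, mul_zero] at hB
    exact (pow_pos hZ 2).not_ge hB
  refine le_iSup₂_of_le G ⟨hG, hG₀⟩ (EReal.coe_le_coe_iff.2 ?_)
  rw [le_div_iff₀ (mul_pos (hM.normX'_pos hG₀) hZ), inv_mul_le_iff₀ (by positivity)]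
  calc M.normX' G * M.normZ2 v ≤ K * M.normZ2 v * M.normZ2 v := by gcongr
    _ = K * M.normZ2 v ^ 2 := by ring
    _ ≤ K * (2 * M.B G v) := by gcongr
    _ = 2 * K * M.B G v := by ring

theorem theorem3p1 (k : ℕ) (ρ c : ℝ) (hρ : 0 < ρ) (hc : 0 < c) :
    ∃ C : ℝ, 0 < C ∧
      ∀ (Ω : Set SDG.Pt), IsOpen Ω → IsConnected Ω → interior (closure Ω) = Ω →
      ∀ M : SDG.MeshData, M.IsMeshOf Ω → M.IsRegular ρ c →
        (C : EReal) ≤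
          ⨅ v ∈ {v : M.VField | v ∈ M.U k ∧ v ≠ 0},
            ⨆ G ∈ {G : M.MField | G ∈ M.WHat Ω k ∧ G ≠ 0},
              ((M.B G v / (M.normX' G * M.normZ2 v) : ℝ) : EReal) := by
  obtain ⟨C, hC, h⟩ := theorem3p1_general k ρ c hρ hc
  exact ⟨C, hC, fun Ω _ _ _ M => h Ω M⟩
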